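/- **Conventions.** An *epigroup* is a semigroup $S$ in which some (positive) power of each element lies in a subgroup of $S$. For $a\in S$ let $G_a$ be the maximal subgroup of $S$ that contains some power of $a$, and let $a^\omega$ be its unit element; then $aa^\omega=a^\omega a\in G_a$, and the inverse of $aa^\omega$ in $G_a$ is called the *pseudoinverse* of $a$ and denoted by $\overline a$. Epigroups are considered as unary semigroups, that is, as algebras with multiplication and the unary operation $a\mapsto\overline a$. A *unary word* is an element of the free unary semigroup over a countably infinite set of letters. The length $\ell(w)$ of a unary word $w$ is the number of occurrences of letters in $w$ if the unary operation does not occur in $w$, and $\ell(w)=\infty$ otherwise. An *epigroup variety* is a class of unary semigroups that is defined by a system of identities between unary words and all of whose members are epigroups with pseudoinversion as the unary operation. For a word $w$, the symbolic identity $w=0$ stands for the identities $wz=zw=w$, where $z$ is a letter that does not occur in $w$. For a positive integer $k$, let $\mathcal F_k=\mathbf V[x^2=x_1\cdots x_k=0,\ xy=yx]$ be the class of all epigroups that satisfy the identities $x^2=0$, $x_1\cdots x_k=0$ and $xy=yx$. A *nilsemigroup* is a semigroup with $0$ in which some power of each element is $0$; it is *nilpotent of degree* $d$ if $d$ is the least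 positive integer such that all products of $d$ of its elements equal $0$. **Corollary 1.3.** Let $n$ be a positive integer. For an epigroup variety $\mathcal V$, the following are equivalent: 1. $\mathcal V$ has degree $\le n$, that is, every nilsemigroup in $\mathcal V$ is nilpotent of degree $\le n$; 2. $\mathcal V$ does not contain $\mathcal F_{n+1}$; 3. $\mathcal V$ satisfies the identity $x_1\cdots x_n=w$ for some unary word $w$ with $\ell(w)>n$; 4. $\mathcal V$ satisfies the identity $$x_1\cdots x_n=x_1\cdots x_{i-1}\cdot\overline{\overline{x_i\cdots x_j}}\cdot x_{j+1}\cdots x_n$$ for some $i,j$ with $1\le i\le j\le n$. -/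

import Mathlib

universe u

namespace EpigroupVarieties

/-- A unary semigroup: a semigroup with one additional unary operation. -/
class UnarySemigroup (S : Type u) extends Semigroup S where
  bar : S → S

/-- The algebras under consideration: unary semigroups with carrier in `Type u`. -/
structure UnarySemigrp : Type (u + 1) where
  carrier : Type u
  [str : UnarySemigroup carrier]

attribute [instance] UnarySemigrp.str

section Semigroups

variable {S : Type u} [Semigroup S]

/-- `seqProd x k = x 0 * x 1 * ⋯ * x k`, a product of `k + 1` elements. -/
def seqProd (x : ℕ → S) : ℕ → S
  | 0 => x 0
  | k + 1 => seqProd x k * x (k + 1)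

/-- `powSucc a k` is the power of `a` with the positive exponent `k + 1`. -/
def powSucc (a : S) (k : ℕ) : S := seqProd (fun _ => a) k

/-- `G` is a subgroup of the semigroup `S`, with unit element `e`. -/
structure IsSubgroupOf (G : Set S) (e : S) : Prop where
  unit_mem : e ∈ G
  mul_mem : ∀ x ∈ G, ∀ y ∈ G, x * y ∈ G
  unit_mul : ∀ x ∈ G, e * x = x
  mul_unit : ∀ x ∈ G, x * e = x
  exists_inv : ∀ x ∈ G, ∃ y ∈ G, x * y = e ∧ y * x = e

/-- `G` is a maximal subgroup of `S`, with unit element `e`. -/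
def IsMaximalSubgroupOf (G : Set S) (e : S) : Prop :=
  IsSubgroupOf G e ∧ ∀ (H : Set S) (f : S), IsSubgroupOf H f → G ⊆ H → H ⊆ G

variable (S) in
/-- An epigroup: some power of each element lies in a subgroup. -/
def IsEpigroup : Prop :=
  ∀ a : S, ∃ (k : ℕ) (G : Set S) (e : S), IsSubgroupOf G e ∧ powSucc a k ∈ G

/-- `b` is the pseudoinverse of `a`: if `G` is the maximal subgroup that contains some power
of `a`, and `e` is its unit element, then `b` is the inverse of `a * e` in the group `G`. -/
def IsPseudoinverse (a b : S) : Prop :=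
  ∃ (G : Set S) (e : S), IsMaximalSubgroupOf G e ∧ (∃ k : ℕ, powSucc a k ∈ G) ∧
    a * e ∈ G ∧ b ∈ G ∧ (a * e) * b = e ∧ b * (a * e) = e

/-- `z` is a zero element of `S`. -/
def IsZeroElement (z : S) : Prop := ∀ x : S, z * x = z ∧ x * z = z

variable (S) in
/-- A nilsemigroup: a semigroup with zero in which some power of each element is zero. -/
def IsNilsemigroup : Prop :=
  ∃ z : S, IsZeroElement z ∧ ∀ a : S, ∃ k : ℕ, powSucc a k = z

variable (S) in
/-- `S` is nilpotent of degree `d`: `d` is the least positive integer such that `S` has a zero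
and every product of `d` elements of `S` is zero. -/
def IsNilpotentOfDegree (d : ℕ) : Prop :=
  IsLeast {m : ℕ | ∃ k : ℕ, m = k + 1 ∧
    ∃ z : S, IsZeroElement z ∧ ∀ x : ℕ → S, seqProd x k = z} d

end Semigroups

/-- An epigroup considered as a unary semigroup, the unary operation being pseudoinversion. -/
def UnarySemigrp.IsEpigroup (S : UnarySemigrp.{u}) : Prop :=
  EpigroupVarieties.IsEpigroup S.carrier ∧
    ∀ a : S.carrier, IsPseudoinverse a (UnarySemigroup.bar a)

/-- Unary words over the letters `x_0, x_1, x_2, …`. They are written with explicit brackets;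
neither the value of a word in a unary semigroup, nor its length, nor the set of its letters
depends on the way in which products are bracketed. -/
inductive Word : Type
  | letter : ℕ → Word
  | mul : Word → Word → Word
  | bar : Word → Word

namespace Word

instance : Mul Word := ⟨Word.mul⟩

/-- The set of letters that occur in a word. -/
def letters : Word → Set ℕ
  | letter i => {i}
  | mul u v => letters u ∪ letters v
  | bar u => letters u

/-- The length of a word: infinite if the unary operation occurs in the word, and the number of
occurrences of letters otherwise. -/
noncomputable def length : Word → ℕ∞
  | letter _ => 1
  | mul u v => length u + length v
  | bar _ => ⊤

/-- The value of a word in a unary semigroup. -/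
def eval {S : Type u} [UnarySemigroup S] (x : ℕ → S) : Word → S
  | letter i => x i
  | mul u v => eval x u * eval x v
  | bar u => UnarySemigroup.bar (eval x u)

/-- `letterSeqMul [a, …, b] w` is the word `x_a ⋯ x_b · w`. -/
def letterSeqMul (l : List ℕ) (w : Word) : Word := l.foldr (fun a v => letter a * v) w

/-- `mulLetterSeq w [a, …, b]` is the word `w · x_a ⋯ x_b`. -/
def mulLetterSeq (w : Word) (l : List ℕ) : Word := l.foldl (fun v a => v * letter a) w

/-- The word `x_i x_{i+1} ⋯ x_j`, for `i ≤ j`. -/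
def block (i j : ℕ) : Word := mulLetterSeq (letter i) (List.range' (i + 1) (j - i))

/-- For `1 ≤ i ≤ j ≤ n`, the word `x_1 ⋯ x_{i-1} · w · x_{j+1} ⋯ x_n`, where `w` is the double
bar of `x_i ⋯ x_j`. -/
def doubleBarWord (n i j : ℕ) : Word :=
  letterSeqMul (List.range' 1 (i - 1))
    (mulLetterSeq (bar (bar (block i j))) (List.range' (j + 1) (n - j)))

end Word

/-- An identity `u = v`. -/
abbrev Identity : Type := Word × Word

/-- The algebra `S` satisfies the identity `p`. -/
def UnarySemigrp.Satisfies (S : UnarySemigrp.{u}) (p : Identity) : Prop :=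
  ∀ x : ℕ → S.carrier, p.1.eval x = p.2.eval x

/-- The class `V` satisfies the identity `u = v`. -/
def ClassSatisfies (V : Set UnarySemigrp.{u}) (u v : Word) : Prop :=
  ∀ S ∈ V, S.Satisfies (u, v)

/-- A variety of unary semigroups: the class of all models of a system of identities. -/
def IsVariety (V : Set UnarySemigrp.{u}) : Prop :=
  ∃ E : Set Identity, V = {S | ∀ p ∈ E, S.Satisfies p}

/-- An epigroup variety: a variety of unary semigroups that consists of epigroups (with
pseudoinversion as the unary operation). -/
def IsEpigroupVariety (V : Set UnarySemigrp.{u}) : Prop :=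
  IsVariety V ∧ ∀ S ∈ V, S.IsEpigroup

/-- The class of all epigroups that satisfy the system of identities `E`. -/
def epigroupsSatisfying (E : Set Identity) : Set UnarySemigrp.{u} :=
  {S | S.IsEpigroup ∧ ∀ p ∈ E, S.Satisfies p}

/-- The symbolic identity `w = 0`: the identities `w z = w` and `z w = w`, where `z` is a letter
that does not occur in `w`. -/
def eqZero (w : Word) : Set Identity :=
  {p | ∃ z : ℕ, z ∉ w.letters ∧ (p = (w * Word.letter z, w) ∨ p = (Word.letter z * w, w))}

/-- For `k ≥ 1`, the variety of epigroups given by `x² = x_1 ⋯ x_k = 0` and `xy = yx`. -/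
def nilVarietyF (k : ℕ) : Set UnarySemigrp.{u} :=
  epigroupsSatisfying
    (eqZero (Word.letter 1 * Word.letter 1) ∪ eqZero (Word.block 1 k) ∪
      {(Word.letter 1 * Word.letter 2, Word.letter 2 * Word.letter 1)})

/-- `V` has degree at most `n`: all nilsemigroups in `V` are nilpotent, and their nilpotency
degrees do not exceed `n`. -/
def HasDegreeAtMost (V : Set UnarySemigrp.{u}) (n : ℕ) : Prop :=
  ∀ S ∈ V, IsNilsemigroup S.carrier → ∃ d : ℕ, d ≤ n ∧ IsNilpotentOfDegree S.carrier d

end EpigroupVarieties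

/-! The implications run in a cycle 1 → 2 → 3 → 4 → 1, and only 3 → 4 is hard. For 1 → 2, the
subsets of an n-element set under disjoint union form a nilsemigroup in F_{n+1} with a nonzero
product of n elements. For 2 → 3, take an identity u = v of V that fails in F_{n+1}; one side, say
u, takes a nonzero value there and so is a product of at most n distinct letters. If v is not
longer, it misses a letter of u, since otherwise it would be a rearrangement of u; barring that
letter in u yields a consequence with a side of infinite length. For 4 → 1, all pseudoinverses in a
nilsemigroup are zero.

For 3 → 4, work in a generic algebra of V. The long identity yields x_1⋯x_n = U g W with g always in
a subgroup (`RegularFactorization`): either w has a barred factor, or pumping produces a power of a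
letter beyond the index. Such an identity keeps the product of two 𝒟-related idempotents in their
𝒥-class (`regularClassesClosed_of_identity`). Hence the factors of a completely regular element g
are closed under products and bars, and g stays completely regular when multiplied by one of its
factors.

Choose the factorization so that g has the most letters and then U, W the fewest factors. If U had
at least j factors for some letter x_j of g, the identity could be applied to U g itself, cut into n
pieces; maximality then puts the letters of the last factor of U into g, so this factor can be
absorbed, against minimality. Thus U and W are short. They contain no bars, since a barred factor
can be stretched at will. Let i and j be the extreme indices of letters of g. Either some x_m is
absent from U g W, so that x_1⋯x_n does not depend on it, or U and W permute the letters outside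
x_i, …, x_j. Iteration undoes the permutation and gives x_1⋯x_n = x_1⋯x_{i-1} g x_{j+1}⋯x_n. Modulo
the congruence of these contexts, b = x_i⋯x_j equals g, hence is completely regular, and there b
agrees with its double bar b·b·(bar b). -/

namespace EpigroupVarieties

/-! ### Completely regular elements and their factors in monoids with Drazin inverses. -/

section CompletelyRegular

variable {M : Type*} [Monoid M]

/-- An element with a commuting inner inverse, that is, an element of a subgroup. -/
def IsCompletelyRegular (g : M) : Prop := ∃ g', g * g' = g' * g ∧ g * g' * g = g

/-- `y` is a factor of `g`. -/
def IsFactor (y g : M) : Prop := ∃ a b, g = a * y * b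

variable (M) in
/-- Every element has a Drazin inverse. -/
def HasDrazinInverses : Prop :=
  ∀ a : M, ∃ b, a * b = b * a ∧ b * a * b = b ∧ ∃ k, a ^ k * a * b = a ^ k

variable (M) in
/-- The product of two mutually `𝒟`-related idempotents stays in their `𝒥`-class. -/
def RegularClassesClosed : Prop :=
  ∀ e h a b : M, e * e = e → h * h = h → b * a = e → a * b = h → h * a = a → a * e = a →
    e * b = b → b * h = b → IsFactor (e * h) e

theorem IsFactor.refl (g : M) : IsFactor g g := ⟨1, 1, by simp⟩

theorem IsFactor.trans {x y z : M} (h₁ : IsFactor x y) (h₂ : IsFactor y z) : IsFactor x z := by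
  obtain ⟨a, b, rfl⟩ := h₁
  obtain ⟨c, d, rfl⟩ := h₂
  exact ⟨c * a, b * d, by simp only [mul_assoc]⟩

theorem IsFactor.of_mul_left {x y z : M} (h : IsFactor (x * y) z) : IsFactor x z := by
  obtain ⟨a, b, rfl⟩ := h
  exact ⟨a, y * b, by simp only [mul_assoc]⟩

theorem IsFactor.of_mul_right {x y z : M} (h : IsFactor (x * y) z) : IsFactor y z := by
  obtain ⟨a, b, rfl⟩ := h
  exact ⟨a * x, b, by simp only [mul_assoc]⟩

/-- Dedekind finiteness of eMe: c^m d^m e = e for all m, and with b the Drazin inverse of c, the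
element cb fixes a power of c and therefore e. So bc = e, and the left inverse b must agree with d.
-/
theorem mul_comm_of_local_inverse (hM : HasDrazinInverses M) {e c d : M} (he : e * e = e)
    (hec : e * c = c) (hce : c * e = c) (hed : e * d = d) (hcd : c * d = e) :
    d * c = e := by
  obtain ⟨b, hcb, hb, k, hk⟩ := hM c
  have hed' : ∀ m : ℕ, e * (d ^ m * e) = d ^ m * e := by
    intro m
    cases m with
    | zero => simp [he]
    | succ m => rw [pow_succ', mul_assoc, ← mul_assoc, hed]
  have h1 : ∀ m : ℕ, c ^ m * (d ^ m * e) = e := by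
    intro m
    induction m with
    | zero => simp
    | succ m ih =>
      calc c ^ (m + 1) * (d ^ (m + 1) * e) = c ^ m * ((c * d) * (d ^ m * e)) := by
            rw [pow_succ, pow_succ']; simp only [mul_assoc]
        _ = e := by rw [hcd, hed', ih]
  have hbk : c * b * c ^ k = c ^ k := by
    have hcomm : Commute (c * b) (c ^ k) := by
      have h0 : Commute b c := hcb.symm
      exact ((Commute.refl c).mul_left h0).pow_right k
    rw [hcomm.eq, ← mul_assoc, hk]
  have h2 : c * b * e = e := by
    rw [← h1 k, ← mul_assoc, hbk]
  have h3 : b * c = e := by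
    have : b * c * e = e := by rw [← hcb, h2]
    rwa [mul_assoc, hce] at this
  calc d * c = e * d * c := by rw [hed]
    _ = b * (c * d) * c := by rw [← h3]; simp only [mul_assoc]
    _ = b * c := by rw [hcd, mul_assoc, hec]
    _ = e := h3

/-- Closure is applied to two pairs of linked idempotents. Each time it gives a one-sided inverse in
eMe, which `mul_comm_of_local_inverse` turns around. -/
theorem exists_local_inverse (hM : HasDrazinInverses M) (hR : RegularClassesClosed M)
    {e y : M} (he : e * e = e) (hy : IsFactor y e) :
    ∃ c, e * c = c ∧ c * e = c ∧ (e * y * e) * c = e ∧ c * (e * y * e) = e := by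
  obtain ⟨α, β, hαβ⟩ := hy
  set a := e * α with ha
  set b := β * e with hb
  have hea : e * a = a := by rw [ha, ← mul_assoc, he]
  have hbe : b * e = b := by rw [hb, mul_assoc, he]
  have hayb : a * y * b = e := by
    calc a * y * b = e * (α * y * β) * e := by rw [ha, hb]; simp only [mul_assoc]
      _ = e := by rw [← hαβ, he, he]
  have hayb' : ∀ z, a * (y * (b * z)) = e * z := by
    intro z; rw [← hayb]; simp only [mul_assoc]
  have hbe' : ∀ z, b * (e * z) = b * z := by intro z; rw [← mul_assoc, hbe]
  have hea' : ∀ z, e * (a * z) = a * z := by intro z; rw [← mul_assoc, hea]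
  have he' : ∀ z, e * (e * z) = e * z := by intro z; rw [← mul_assoc, he]
  -- First pair: bay and e, linked by ay and b.
  obtain ⟨l, hl⟩ : ∃ l, l * y * e = e := by
    obtain ⟨μ, ν, h⟩ := hR (b * a * y) e (a * y) b (by simp only [mul_assoc, hayb', hea']) he
      (by simp only [mul_assoc]) hayb
      (by simp only [hea']) (by simp only [mul_assoc, hayb', hea'])
      (by rw [mul_assoc, mul_assoc, ← mul_assoc a, hayb, hbe]) hbe
    have hcd : (e * (a * y * μ) * (b * a * y) * e) * (e * ν * b * e) = e := by
      calc _ = e * a * y * (μ * (b * a * y * e) * ν) * b * e := by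
            simp only [mul_assoc, he']
        _ = e * (a * y * b * (a * y * b)) * e := by rw [← h]; simp only [mul_assoc]
        _ = e := by rw [hayb, he, he, he]
    have h2 := mul_comm_of_local_inverse hM he (by simp only [mul_assoc, he'])
      (by simp only [mul_assoc, he]) (by simp only [mul_assoc, he']) hcd
    exact ⟨(e * ν * b * e) * (e * (a * y * μ) * (b * a)), by simpa only [mul_assoc] using h2⟩
  have hl' : ∀ z, l * (y * (e * z)) = e * z := by
    intro z; rw [← mul_assoc, ← mul_assoc, hl]
  have hl0 : l * (y * e) = e := by rw [← mul_assoc, hl]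
  -- Second pair: e and yel, linked by ye and el.
  obtain ⟨μ, ν, h⟩ := hR e (y * e * (e * l)) (y * e) (e * l) he
    (by simp only [mul_assoc, he', hl'])
    (by simp only [mul_assoc, hl0, he]) rfl
    (by simp only [mul_assoc, hl0, he]) (by simp only [mul_assoc, he]) (by simp only [he'])
    (by simp only [mul_assoc, he', hl'])
  have hcd : (e * μ * e) * (e * y * e * l * ν * e) = e := by
    calc _ = e * (μ * (e * (y * e * (e * l))) * ν) * e := by simp only [mul_assoc, he']
      _ = e := by rw [← h, he, he]
  have h2 := mul_comm_of_local_inverse hM he (by simp only [mul_assoc, he'])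
    (by simp only [mul_assoc, he]) (by simp only [mul_assoc, he']) hcd
  have h3 : (e * y * e) * (e * (l * ν * e * (e * μ * e))) = e := by
    refine Eq.trans ?_ h2
    simp only [mul_assoc, he']
  refine ⟨e * (l * ν * e * (e * μ * e)), by simp only [he'], by simp only [mul_assoc, he], h3, ?_⟩
  exact mul_comm_of_local_inverse hM he (by simp only [mul_assoc, he'])
    (by simp only [mul_assoc, he]) (by simp only [he']) h3

theorem IsCompletelyRegular.exists_group_inverse {g : M} (hg : IsCompletelyRegular g) :
    ∃ e g', e * e = e ∧ g * g' = e ∧ g' * g = e ∧ e * g = g ∧ g * e = g ∧ e * g' = g' ∧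
      g' * e = g' := by
  obtain ⟨g', h1, h2⟩ := hg
  have h3 : g' * g * g = g := by rw [← h1, h2]
  have h4 : g * (g' * g) = g := by rw [← mul_assoc, h2]
  refine ⟨g * g', g' * (g * g'), ?_, ?_, ?_, h2, ?_, ?_, ?_⟩
  · rw [← mul_assoc, h2]
  · rw [← mul_assoc, ← mul_assoc, h2]
  · rw [mul_assoc, h2, h1]
  · rw [h1, h4]
  · have h5 : g * g' * g' = g' * (g * g') := by rw [h1, mul_assoc, h1]
    rw [← mul_assoc, h5, mul_assoc, ← mul_assoc (g * g'), h2]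
  · rw [mul_assoc, ← mul_assoc (g * g'), h2]

/-- With c the inverse of eye in eMe, cyg = g = gyc. So c undoes the multiplication by y, and ycg'c
and cg'cy are the required commuting inner inverses. -/
theorem IsCompletelyRegular.mul_factor (hM : HasDrazinInverses M) (hR : RegularClassesClosed M)
    {g y : M} (hg : IsCompletelyRegular g) (hy : IsFactor y g) :
    (IsCompletelyRegular (y * g) ∧ IsFactor (y * g) g) ∧
      (IsCompletelyRegular (g * y) ∧ IsFactor (g * y) g) := by
  obtain ⟨e, g', he, hgg, hgg', heg, hge, heg', hge'⟩ := hg.exists_group_inverse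
  have hye : IsFactor y e := by
    obtain ⟨a, b, h⟩ := hy
    exact ⟨a, b * g', by rw [← hgg]; nth_rewrite 1 [h]; simp only [mul_assoc]⟩
  obtain ⟨c, hec, hce, h1, h2⟩ := exists_local_inverse hM hR he hye
  have hcyg : c * y * g = g := by
    calc c * y * g = c * (e * y * e) * g := by
          simp only [← mul_assoc]; rw [hce, mul_assoc (c * y), heg]
      _ = g := by rw [h2, heg]
  have hgyc : g * y * c = g := by
    calc g * y * c = g * ((e * y * e) * c) := by
          simp only [← mul_assoc]; rw [hge, mul_assoc (g * y), hec]
      _ = g := by rw [h1, hge]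
  refine ⟨⟨⟨y * c * g' * c, ?_, ?_⟩, ⟨c, 1, by rw [mul_one, ← mul_assoc, hcyg]⟩⟩,
    ⟨⟨c * g' * c * y, ?_, ?_⟩, ⟨1, c, by rw [one_mul, hgyc]⟩⟩⟩
  · calc y * g * (y * c * g' * c) = y * ((g * y * c) * g') * c := by simp only [mul_assoc]
      _ = y * c := by rw [hgyc, hgg, mul_assoc, hec]
      _ = y * c * (g' * g) := by rw [hgg', mul_assoc, hce]
      _ = y * c * (g' * (c * y * g)) := by rw [hcyg]
      _ = _ := by simp only [mul_assoc]
  · calc y * g * (y * c * g' * c) * (y * g) = y * ((g * y * c) * g') * (c * y * g) := by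
          simp only [mul_assoc]
      _ = y * g := by rw [hgyc, hgg, hcyg, mul_assoc, heg]
  · calc g * y * (c * g' * c * y) = (g * y * c) * g' * c * y := by simp only [mul_assoc]
      _ = c * y := by rw [hgyc, hgg, hec]
      _ = c * (g' * g) * y := by rw [hgg', hce]
      _ = c * (g' * (c * y * g)) * y := by rw [hcyg]
      _ = _ := by simp only [mul_assoc]
  · calc g * y * (c * g' * c * y) * (g * y) = (g * y * c) * g' * (c * y * g) * y := by
          simp only [mul_assoc]
      _ = g * y := by rw [hgyc, hgg, hcyg, heg]

/-- Since yg is again completely regular and has x as a factor, xyg is a factor of yg, which is a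
factor of g. -/
theorem IsFactor.mul_of_completelyRegular (hM : HasDrazinInverses M)
    (hR : RegularClassesClosed M) {g x y : M} (hg : IsCompletelyRegular g)
    (hx : IsFactor x g) (hy : IsFactor y g) : IsFactor (x * y) g := by
  obtain ⟨⟨h1, h2⟩, -⟩ := hg.mul_factor hM hR hy
  have h3 : IsFactor x (y * g) := hx.trans ⟨y, 1, by simp⟩
  have h4 := (h1.mul_factor hM hR h3).1.2.trans h2
  rw [← mul_assoc] at h4
  exact h4.of_mul_left

theorem IsFactor.pow_of_completelyRegular (hM : HasDrazinInverses M)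
    (hR : RegularClassesClosed M) {g x : M} (hg : IsCompletelyRegular g)
    (hx : IsFactor x g) (k : ℕ) : IsFactor (x ^ k) g := by
  induction k with
  | zero => exact ⟨g, 1, by simp⟩
  | succ k ih => rw [pow_succ]; exact ih.mul_of_completelyRegular hM hR hg hx

end CompletelyRegular

end EpigroupVarieties

namespace EpigroupVarieties

/-! ### The double Drazin inverse. -/

section DrazinUniqueness

/-- The idempotent ab satisfies ab = ab·a^k b^k for every k. Taking k = m, where bc fixes b^m, gives
bc = ab, and then c = c·bc = a·a·b. -/
theorem drazin_inverse_of_drazin_inverse {M : Type*} [Monoid M] {a b c : M} {m : ℕ}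
    (hab : a * b = b * a) (hb : b * a * b = b) (hbc : b * c = c * b) (hc : c * b * c = c)
    (hm : b ^ m * b * c = b ^ m) : c = a * a * b := by
  have h1 : ∀ k : ℕ, a * b = a * b * (a ^ k * b ^ k) := by
    intro k
    induction k with
    | zero => simp
    | succ k ih =>
      have hcomm : Commute (a * b) (a ^ k) := by
        have h0 : Commute b a := hab.symm
        exact ((Commute.refl a).mul_left h0).pow_right k
      have h2 : a * b * (a * b) = a * b := by
        rw [mul_assoc, ← mul_assoc b, hb]
      calc a * b = a * b * (a * b) := h2.symm
        _ = (a * b) * (a * b * (a ^ k * b ^ k)) := by rw [← ih]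
        _ = (a * b) * (a ^ k * (a * b) * b ^ k) := by rw [← hcomm.eq]; simp only [mul_assoc]
        _ = _ := by rw [pow_succ, pow_succ']; simp only [mul_assoc]
  have h3 : a * b * (b * c) = a * b := by
    calc a * b * (b * c) = a * b * (a ^ m * b ^ m) * (b * c) := by rw [← h1]
      _ = a * b * (a ^ m * (b ^ m * b * c)) := by simp only [mul_assoc]
      _ = a * b := by rw [hm, ← h1]
  have h4 : b * c = a * b := by
    rw [← h3, ← mul_assoc (a * b), hab, hb]
  calc c = c * (b * c) := by rw [← mul_assoc, hc]
    _ = (c * b) * a := by rw [h4, hab, mul_assoc]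
    _ = a * a * b := by rw [← hbc, h4, mul_assoc, ← hab, mul_assoc]

end DrazinUniqueness

/-! ### Equational laws of pseudoinversion. -/

section BarLaws

theorem coe_powSucc {S : Type u} [Semigroup S] (a : S) (k : ℕ) :
    ((powSucc a k : S) : WithOne S) = (a : WithOne S) ^ (k + 1) := by
  induction k with
  | zero => simp [powSucc, seqProd]
  | succ k ih => rw [pow_succ, ← ih]; rfl

/-- The basic laws of pseudoinversion, in the monoid obtained by adjoining a unit. -/
structure BarLaws (S : Type u) [UnarySemigroup S] : Prop where
  mul_bar : ∀ a : S, a * UnarySemigroup.bar a = UnarySemigroup.bar a * a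
  bar_mul_bar : ∀ a : S,
    UnarySemigroup.bar a * a * UnarySemigroup.bar a = UnarySemigroup.bar a
  pow_mul_bar : ∀ a : S, ∃ k : ℕ,
    (a : WithOne S) ^ (k + 1) * a * (UnarySemigroup.bar a : S) = (a : WithOne S) ^ (k + 1)
  bar_bar : ∀ a : S, UnarySemigroup.bar (UnarySemigroup.bar a) = a * a * UnarySemigroup.bar a

/-- The unit e of the group containing the power c of a commutes with a, because c does and e = c'c.
Hence ab = ba = e. -/
theorem IsPseudoinverse.laws {S : Type u} [Semigroup S] {a b : S} (h : IsPseudoinverse a b) :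
    a * b = b * a ∧ b * a * b = b ∧
      ∃ k : ℕ, (a : WithOne S) ^ (k + 1) * a * b = (a : WithOne S) ^ (k + 1) := by
  obtain ⟨G, e, ⟨hG, -⟩, ⟨k, hk⟩, hae, hb, h1, h2⟩ := h
  obtain ⟨c', hc', hcc', hc'c⟩ := hG.exists_inv _ hk
  set c := powSucc a k with hc
  have hac : a * c = c * a := by
    apply WithOne.coe_injective
    rw [WithOne.coe_mul, WithOne.coe_mul, hc, coe_powSucc, ← pow_succ, ← pow_succ']
  have hea : e * a = a * e := by
    calc e * a = c' * (a * c) := by rw [hac, ← mul_assoc, hc'c]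
      _ = c' * (a * (c * e)) := by rw [hG.mul_unit _ hk]
      _ = (c' * (a * c)) * e := by simp only [mul_assoc]
      _ = e * (a * e) := by rw [hac, ← mul_assoc, hc'c, mul_assoc]
      _ = a * e := hG.unit_mul _ hae
  have hab : a * b = e := by rw [← hG.unit_mul _ hb, ← mul_assoc, h1]
  have hba : b * a = e := by
    rw [← hG.mul_unit _ hb, mul_assoc, hea, h2]
  refine ⟨hab.trans hba.symm, by rw [hba, hG.unit_mul _ hb], k, ?_⟩
  rw [← coe_powSucc, ← hc, mul_assoc, ← WithOne.coe_mul, hab, ← WithOne.coe_mul,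
    hG.mul_unit _ hk]

theorem barLaws_of_isPseudoinverse {S : Type u} [UnarySemigroup S]
    (h : ∀ a : S, IsPseudoinverse a (UnarySemigroup.bar a)) : BarLaws S where
  mul_bar a := (h a).laws.1
  bar_mul_bar a := (h a).laws.2.1
  pow_mul_bar a := (h a).laws.2.2
  bar_bar a := by
    obtain ⟨h1, h2, -⟩ := (h a).laws
    obtain ⟨h3, h4, k, h5⟩ := (h (UnarySemigroup.bar a)).laws
    apply WithOne.coe_injective
    simp only [WithOne.coe_mul]
    refine drazin_inverse_of_drazin_inverse (b := ((UnarySemigroup.bar a : S) : WithOne S))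
      (m := k + 1) ?_ ?_ ?_ ?_ h5
    · exact_mod_cast congrArg WithOne.coe h1
    · exact_mod_cast congrArg WithOne.coe h2
    · exact_mod_cast congrArg WithOne.coe h3
    · exact_mod_cast congrArg WithOne.coe h4

theorem BarLaws.hasDrazinInverses {S : Type u} [UnarySemigroup S] (h : BarLaws S) :
    HasDrazinInverses (WithOne S) := by
  intro a
  induction a using WithOne.recOneCoe with
  | one => exact ⟨1, rfl, by simp, 0, by simp⟩
  | coe a =>
    obtain ⟨k, hk⟩ := h.pow_mul_bar a
    exact ⟨(UnarySemigroup.bar a : S), by exact_mod_cast congrArg WithOne.coe (h.mul_bar a),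
      by exact_mod_cast congrArg WithOne.coe (h.bar_mul_bar a), k + 1, hk⟩

theorem BarLaws.isCompletelyRegular_bar {S : Type u} [UnarySemigroup S] (h : BarLaws S)
    (a : S) : IsCompletelyRegular ((UnarySemigroup.bar a : S) : WithOne S) :=
  ⟨a, by exact_mod_cast congrArg WithOne.coe (h.mul_bar a).symm,
    by exact_mod_cast congrArg WithOne.coe (h.bar_mul_bar a)⟩

theorem BarLaws.isFactor_bar {S : Type u} [UnarySemigroup S] (h : BarLaws S)
    (hR : RegularClassesClosed (WithOne S)) {a : S} {g : WithOne S}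
    (hg : IsCompletelyRegular g) (ha : IsFactor (a : WithOne S) g) :
    IsFactor ((UnarySemigroup.bar a : S) : WithOne S) g := by
  obtain ⟨k, hk⟩ := h.pow_mul_bar a
  have h1 := ha.pow_of_completelyRegular h.hasDrazinInverses hR hg (k + 1)
  rw [← hk] at h1
  exact h1.of_mul_right

/-- Completely regular elements have index one: g = g'^k g^(k+1) lets the excess power be cancelled.
-/
theorem IsCompletelyRegular.mul_mul_eq_self {M : Type*} [Monoid M] {g c : M} {k : ℕ}
    (hg : IsCompletelyRegular g) (hk : g ^ (k + 1) * g * c = g ^ (k + 1)) : g * g * c = g := by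
  obtain ⟨g', h1, h2⟩ := hg
  have h3 : ∀ m : ℕ, g = g' ^ m * g ^ (m + 1) := by
    intro m
    induction m with
    | zero => simp
    | succ m ih =>
      calc g = g' * g * g := by rw [← h1, h2]
        _ = g' * (g' ^ m * g ^ (m + 1)) * g := by rw [← ih]
        _ = _ := by rw [pow_succ' g', pow_succ g (m + 1)]; simp only [mul_assoc]
  calc g * g * c = g' ^ k * (g ^ (k + 1) * g * c) := by
        nth_rewrite 1 [h3 k]; simp only [mul_assoc]
    _ = g := by rw [hk, ← h3]

theorem BarLaws.mul_mul_bar_of_isCompletelyRegular {S : Type u} [UnarySemigroup S]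
    (h : BarLaws S) {g : S} (hg : IsCompletelyRegular (g : WithOne S)) :
    (g : WithOne S) * g * (UnarySemigroup.bar g : S) = g := by
  obtain ⟨k, hk⟩ := h.pow_mul_bar g
  exact hg.mul_mul_eq_self hk

theorem isCompletelyRegular_pow {M : Type*} [Monoid M] {a b : M} {k : ℕ} (hab : a * b = b * a)
    (hk : a ^ k * a * b = a ^ k) : IsCompletelyRegular (a ^ k) := by
  have hc : Commute a b := hab
  refine ⟨b ^ k, hc.pow_pow k k, ?_⟩
  have h1 : ∀ m : ℕ, a ^ k * (a * b) ^ m = a ^ k := by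
    intro m
    induction m with
    | zero => simp
    | succ m ih => rw [pow_succ, ← mul_assoc, ih, ← mul_assoc, hk]
  rw [mul_assoc, ← (hc.pow_pow k k).eq, ← hc.mul_pow, h1]

end BarLaws

/-! ### Substitution in words and their letters. -/

namespace Word

/-- Substitution of words for letters. -/
def subst (σ : ℕ → Word) : Word → Word
  | letter i => σ i
  | mul u v => mul (subst σ u) (subst σ v)
  | bar u => bar (subst σ u)

theorem eval_letter {S : Type u} [UnarySemigroup S] (x : ℕ → S) (i : ℕ) :
    (letter i).eval x = x i := rfl

theorem eval_mul {S : Type u} [UnarySemigroup S] (x : ℕ → S) (u v : Word) :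
    (u * v).eval x = u.eval x * v.eval x := rfl

theorem eval_bar {S : Type u} [UnarySemigroup S] (x : ℕ → S) (u : Word) :
    (bar u).eval x = UnarySemigroup.bar (u.eval x) := rfl

theorem eval_subst {S : Type u} [UnarySemigroup S] (x : ℕ → S) (σ : ℕ → Word) (w : Word) :
    (w.subst σ).eval x = w.eval fun i => (σ i).eval x := by
  induction w with
  | letter i => rfl
  | mul u v hu hv => simp only [subst, eval, hu, hv]
  | bar u hu => simp only [subst, eval, hu]

theorem letters_subst (σ : ℕ → Word) (w : Word) :
    (w.subst σ).letters = ⋃ i ∈ w.letters, (σ i).letters := by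
  induction w with
  | letter i => simp [subst, letters]
  | mul u v hu hv => simp only [subst, letters, hu, hv, Set.biUnion_union]
  | bar u hu => simp only [subst, letters, hu]

theorem eval_congr {S : Type u} [UnarySemigroup S] {x y : ℕ → S} {w : Word}
    (h : ∀ i ∈ w.letters, x i = y i) : w.eval x = w.eval y := by
  induction w with
  | letter i => exact h i rfl
  | mul u v hu hv =>
    simp only [eval]
    rw [hu fun i hi => h i (Or.inl hi), hv fun i hi => h i (Or.inr hi)]
  | bar u hu => simp only [eval]; rw [hu h]

theorem letters_nonempty (w : Word) : w.letters.Nonempty := by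
  induction w with
  | letter i => exact ⟨i, rfl⟩
  | mul u v hu hv => exact hu.inl
  | bar u hu => exact hu

theorem letters_finite (w : Word) : w.letters.Finite := by
  induction w with
  | letter i => exact Set.finite_singleton i
  | mul u v hu hv => exact hu.union hv
  | bar u hu => exact hu

end Word

/-! ### The relatively free algebra. -/

section RelativelyFree

variable (V : Set UnarySemigrp.{u})

/-- Equality of words modulo the identities of a class. -/
def identitySetoid : Setoid (ULift.{u} Word) where
  r a b := ClassSatisfies V a.down b.down
  iseqv :=
    { refl := fun _ _ _ _ => rfl
      symm := fun h S hS x => (h S hS x).symm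
      trans := fun h₁ h₂ S hS x => (h₁ S hS x).trans (h₂ S hS x) }

/-- The algebra of words modulo the identities of a class. -/
def FreeAlgebraOf : Type u := Quotient (identitySetoid V)

instance : UnarySemigroup (FreeAlgebraOf V) where
  mul := Quotient.map₂ (fun a b => ⟨a.down * b.down⟩) (by
    intro a a' ha b b' hb S hS x
    exact congrArg₂ (· * ·) (ha S hS x) (hb S hS x))
  mul_assoc := by
    rintro ⟨a⟩ ⟨b⟩ ⟨c⟩
    exact Quotient.sound fun S hS x => mul_assoc _ _ _
  bar := Quotient.map (fun a => ⟨Word.bar a.down⟩) (by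
    intro a a' ha S hS x
    exact congrArg UnarySemigroup.bar (ha S hS x))

/-- The class of a word. -/
def FreeAlgebraOf.mk (w : Word) : FreeAlgebraOf V := Quotient.mk (identitySetoid V) ⟨w⟩

theorem FreeAlgebraOf.eval_mk (σ : ℕ → Word) (w : Word) :
    w.eval (fun i => mk V (σ i)) =
      mk V (w.subst σ) := by
  induction w with
  | letter i => rfl
  | mul u v hu hv => simp only [Word.eval]; rw [hu, hv]; rfl
  | bar u hu => simp only [Word.eval]; rw [hu]; rfl

variable {V}

/-- A variety contains an algebra with a generic sequence of elements. -/
theorem IsVariety.exists_generic (hV : IsVariety V) :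
    ∃ S ∈ V, ∃ ξ : ℕ → S.carrier, ∀ u v : Word, u.eval ξ = v.eval ξ → ClassSatisfies V u v := by
  refine ⟨⟨FreeAlgebraOf V⟩, ?_,
    fun i => FreeAlgebraOf.mk V (Word.letter i), ?_⟩
  · obtain ⟨E, hE⟩ := hV
    have key : ∀ p ∈ E, (⟨FreeAlgebraOf V⟩ : UnarySemigrp.{u}).Satisfies p := by
      intro p hp x
      obtain ⟨σ, hσ⟩ : ∃ σ : ℕ → Word,
          x = fun i => FreeAlgebraOf.mk V (σ i) :=
        ⟨fun i => (Quotient.out (x i)).down, funext fun i => (Quotient.out_eq (x i)).symm⟩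
      rw [hσ]
      refine (FreeAlgebraOf.eval_mk V σ p.1).trans
        (Eq.trans (Quotient.sound ?_) (FreeAlgebraOf.eval_mk V σ p.2).symm)
      intro S hS y
      change (p.1.subst σ).eval y = (p.2.subst σ).eval y
      rw [Word.eval_subst, Word.eval_subst]
      rw [hE] at hS
      exact hS p hp _
    have hmem : ∀ T : UnarySemigrp.{u}, (∀ p ∈ E, T.Satisfies p) → T ∈ V := by
      rw [hE]; exact fun T hT => hT
    exact hmem _ key
  · intro u v h
    have h' := (FreeAlgebraOf.eval_mk V Word.letter u).symm.trans
      (h.trans (FreeAlgebraOf.eval_mk V Word.letter v))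
    have h2 := Quotient.exact h'
    intro S hS x
    have h3 : (u.subst Word.letter).eval x = (v.subst Word.letter).eval x := h2 S hS x
    rw [Word.eval_subst, Word.eval_subst] at h3
    exact h3

end RelativelyFree

end EpigroupVarieties

namespace EpigroupVarieties

/-! ### Values of possibly empty products. -/

section Evaluation

variable {S : Type u} [UnarySemigroup S]

/-- The value of a possibly empty product of words. -/
def wordsEval (x : ℕ → S) (L : List Word) : WithOne S :=
  (L.map fun w => ((w.eval x : S) : WithOne S)).prod

/-- The value of a possibly empty product of letters. -/
def listEval (x : ℕ → S) (l : List ℕ) : WithOne S := (l.map fun i => (x i : WithOne S)).prod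

@[simp] theorem wordsEval_nil (x : ℕ → S) : wordsEval x [] = 1 := rfl

@[simp] theorem wordsEval_cons (x : ℕ → S) (w : Word) (L : List Word) :
    wordsEval x (w :: L) = ((w.eval x : S) : WithOne S) * wordsEval x L := by simp [wordsEval]

@[simp] theorem wordsEval_append (x : ℕ → S) (L L' : List Word) :
    wordsEval x (L ++ L') = wordsEval x L * wordsEval x L' := by simp [wordsEval]

@[simp] theorem listEval_nil (x : ℕ → S) : listEval x [] = 1 := rfl

@[simp] theorem listEval_cons (x : ℕ → S) (i : ℕ) (l : List ℕ) :
    listEval x (i :: l) = (x i : WithOne S) * listEval x l := by simp [listEval]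

@[simp] theorem listEval_append (x : ℕ → S) (l l' : List ℕ) :
    listEval x (l ++ l') = listEval x l * listEval x l' := by simp [listEval]

theorem listEval_congr {x y : ℕ → S} {l : List ℕ} (h : ∀ i ∈ l, x i = y i) :
    listEval x l = listEval y l := by
  unfold listEval
  congr 1
  exact List.map_congr_left fun i hi => by rw [h i hi]

theorem listEval_const {x : ℕ → S} {l : List ℕ} {a : S} (h : ∀ i ∈ l, x i = a) :
    listEval x l = (a : WithOne S) ^ l.length := by
  rw [listEval_congr (y := fun _ => a) h, listEval]
  simp

theorem wordsEval_map_letter (x : ℕ → S) (l : List ℕ) :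
    wordsEval x (l.map Word.letter) = listEval x l := by
  simp [wordsEval, listEval, Function.comp_def, Word.eval_letter]

theorem wordsEval_map_subst (x : ℕ → S) (σ : ℕ → Word) (L : List Word) :
    wordsEval x (L.map (Word.subst σ)) = wordsEval (fun i => (σ i).eval x) L := by
  simp [wordsEval, Function.comp_def, Word.eval_subst]

namespace Word

theorem coe_eval_mulLetterSeq (x : ℕ → S) (w : Word) (l : List ℕ) :
    (((mulLetterSeq w l).eval x : S) : WithOne S) = (w.eval x : S) * listEval x l := by
  induction l generalizing w with
  | nil => simp [mulLetterSeq]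
  | cons a l ih =>
    have := ih (w * letter a)
    rw [eval_mul, eval_letter, WithOne.coe_mul, mul_assoc] at this
    simpa [mulLetterSeq] using this

theorem coe_eval_letterSeqMul (x : ℕ → S) (w : Word) (l : List ℕ) :
    (((letterSeqMul l w).eval x : S) : WithOne S) = listEval x l * (w.eval x : S) := by
  induction l with
  | nil => simp [letterSeqMul]
  | cons a l ih =>
    rw [listEval_cons, mul_assoc, ← ih, ← eval_letter x, ← WithOne.coe_mul, ← eval_mul]
    rfl

theorem coe_eval_block (x : ℕ → S) {i j : ℕ} (h : i ≤ j) :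
    (((block i j).eval x : S) : WithOne S) = listEval x (List.range' i (j + 1 - i)) := by
  rw [block, coe_eval_mulLetterSeq, eval_letter, show j + 1 - i = (j - i) + 1 by omega,
    List.range'_succ, listEval_cons]

theorem coe_eval_doubleBarWord (x : ℕ → S) (n i j : ℕ) :
    (((doubleBarWord n i j).eval x : S) : WithOne S) =
      listEval x (List.range' 1 (i - 1)) *
        ((UnarySemigroup.bar (UnarySemigroup.bar ((block i j).eval x)) : S) *
          listEval x (List.range' (j + 1) (n - j))) := by
  rw [doubleBarWord, coe_eval_letterSeqMul, coe_eval_mulLetterSeq]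
  rfl

open Classical in
/-- The number of occurrences of the letter `q`, infinite if `q` occurs under a bar. -/
noncomputable def count (q : ℕ) : Word → ℕ∞
  | letter i => if i = q then 1 else 0
  | mul u v => count q u + count q v
  | bar u => if q ∈ u.letters then ⊤ else 0

theorem count_eq_zero {q : ℕ} {w : Word} (h : q ∉ w.letters) : w.count q = 0 := by
  induction w with
  | letter i => simp only [letters, Set.mem_singleton_iff] at h; simp [count, Ne.symm h]
  | mul u v hu hv =>
    simp only [letters, Set.mem_union, not_or] at h
    simp [count, hu h.1, hv h.2]
  | bar u hu => simp only [letters] at h; simp [count, h]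

end Word

theorem listEval_range'_split (x : ℕ → S) {n q : ℕ} (h1 : 1 ≤ q) (h2 : q ≤ n) :
    listEval x (List.range' 1 n) =
      listEval x (List.range' 1 (q - 1)) * (x q * listEval x (List.range' (q + 1) (n - q))) := by
  have : List.range' 1 n = List.range' 1 (q - 1) ++ q :: List.range' (q + 1) (n - q) := by
    have h3 := List.range'_append (s := 1) (m := q - 1) (n := n - q + 1) (step := 1)
    rw [show 1 + 1 * (q - 1) = q by omega, List.range'_succ,
      show q - 1 + (n - q + 1) = n by omega] at h3
    exact h3.symm
  rw [this, listEval_append, listEval_cons]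

end Evaluation

/-! ### Nonlinear identities keep products of linked idempotents in their 𝒥-class. -/

section NonlinearIdentity

variable {S : Type u} [UnarySemigroup S]

theorem BarLaws.bar_of_idempotent (h : BarLaws S) {a : S} (ha : a * a = a) :
    UnarySemigroup.bar a = a := by
  obtain ⟨k, hk⟩ := h.pow_mul_bar a
  have hpow : ∀ m : ℕ, (a : WithOne S) ^ (m + 1) = a := by
    intro m
    induction m with
    | zero => simp
    | succ m ih => rw [pow_succ, ih, ← WithOne.coe_mul, ha]
  rw [hpow] at hk
  have h1 : a * UnarySemigroup.bar a = a := by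
    have : a * a * UnarySemigroup.bar a = a := by exact_mod_cast hk
    rwa [ha] at this
  rw [← h.bar_mul_bar, ← h.mul_bar, h1, h1]

/-- With b the bar of a, b = (ba)(ba)b = bb·aa·b. This detects forbidden factors under a bar. -/
theorem BarLaws.isFactor_mul_self_bar (h : BarLaws S) (a : S) :
    IsFactor ((a : WithOne S) * a) (UnarySemigroup.bar a : S) := by
  set b := UnarySemigroup.bar a with hb
  have h1 : b = b * b * (a * a) * b := by
    have e1 : b * a * b = b := h.bar_mul_bar a
    have e2 : a * b = b * a := h.mul_bar a
    calc b = b * a * b := e1.symm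
      _ = b * a * (b * a * b) := by rw [e1, e1]
      _ = b * (a * b) * (a * b) := by simp only [mul_assoc]
      _ = b * (b * a) * (a * b) := by rw [e2]
      _ = b * b * (a * a) * b := by simp only [mul_assoc]
  exact ⟨(b * b : S), b, by exact_mod_cast congrArg WithOne.coe h1⟩

theorem WithOne.eq_one_of_mul_eq_one {S : Type*} [Semigroup S] {a b : WithOne S}
    (h : a * b = 1) : a = 1 ∧ b = 1 := by
  induction a using WithOne.recOneCoe with
  | one => exact ⟨rfl, by simpa using h⟩
  | coe a =>
    induction b using WithOne.recOneCoe with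
    | one => simp at h
    | coe b => exact absurd h (by rw [← WithOne.coe_mul]; exact WithOne.coe_ne_one)

/-- The assignment is f, …, f, a, e, …, e with a = fa = ae. A step back, from e or a to f or a,
creates the factor ef. If this factor is avoided, a subword has value e, f or fe without x_q, or
value a with a single unbarred x_q; barring fe or a would bring in its square, which contains ef. -/
theorem Word.eval_path (h : BarLaws S) {x : ℕ → S} {q : ℕ} {e f a : S}
    (he : e * e = e) (hf : f * f = f) (hfa : f * a = a) (hae : a * e = a)
    (hlt : ∀ m < q, x m = f) (heq : x q = a) (hgt : ∀ m, q < m → x m = e) (w : Word)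
    (hw : ¬ IsFactor ((e * f : S) : WithOne S) (w.eval x : S)) :
    (q ∉ w.letters ∧ (w.eval x = e ∨ w.eval x = f ∨ w.eval x = f * e)) ∨
      (w.eval x = a ∧ w.count q = 1) := by
  have hea : e * a = e * f * a := by rw [mul_assoc, hfa]
  have haf : a * f = a * (e * f) := by rw [← mul_assoc, hae]
  have bad : ∀ {c : S} (u v : WithOne S), (c : WithOne S) = u * (e * f : S) * v →
      IsFactor ((e * f : S) : WithOne S) (c : WithOne S) := fun u v huv => ⟨u, v, huv⟩
  induction w with
  | letter i =>
    simp only [letters, Set.mem_singleton_iff, eval, count]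
    rcases lt_trichotomy i q with hi | rfl | hi
    · left; exact ⟨hi.ne', Or.inr (Or.inl (hlt i hi))⟩
    · right; simp [heq]
    · left; exact ⟨hi.ne, Or.inl (hgt i hi)⟩
  | mul u v hu hv =>
    change ¬ IsFactor _ ((u.eval x * v.eval x : S) : WithOne S) at hw
    rw [WithOne.coe_mul] at hw
    have hu' := hu fun h => hw (h.trans ⟨1, (v.eval x : S), by simp⟩)
    have hv' := hv fun h => hw (h.trans ⟨(u.eval x : S), 1, by simp⟩)
    rw [← WithOne.coe_mul] at hw
    simp only [letters, Set.mem_union, not_or, eval, count]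
    rcases hu' with ⟨hu1, hu2⟩ | ⟨hu2, hu1⟩ <;> rcases hv' with ⟨hv1, hv2⟩ | ⟨hv2, hv1⟩
    · left
      refine ⟨⟨hu1, hv1⟩, ?_⟩
      rcases hu2 with hu2 | hu2 | hu2 <;> rcases hv2 with hv2 | hv2 | hv2 <;>
        rw [hu2, hv2] at hw ⊢
      · exact Or.inl he
      · exact (hw (bad 1 1 (by simp))).elim
      · exact (hw (bad 1 e (by simp [mul_assoc]))).elim
      · exact Or.inr (Or.inr rfl)
      · exact Or.inr (Or.inl hf)
      · exact Or.inr (Or.inr (by rw [← mul_assoc, hf]))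
      · exact Or.inr (Or.inr (by rw [mul_assoc, he]))
      · exact (hw (bad f 1 (by simp [mul_assoc]))).elim
      · exact (hw (bad f e (by simp [mul_assoc]))).elim
    · rw [count_eq_zero hu1, hv1, zero_add]
      rw [hv2] at hw ⊢
      rcases hu2 with hu2 | hu2 | hu2 <;> rw [hu2] at hw ⊢
      · exact (hw (bad 1 a (by rw [hea]; simp))).elim
      · exact Or.inr ⟨hfa, rfl⟩
      · exact (hw (bad f a (by rw [mul_assoc, hea]; simp [mul_assoc]))).elim
    · rw [count_eq_zero hv1, hu1, add_zero]
      rw [hu2] at hw ⊢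
      rcases hv2 with hv2 | hv2 | hv2 <;> rw [hv2] at hw ⊢
      · exact Or.inr ⟨hae, rfl⟩
      · exact (hw (bad a 1 (by rw [haf]; simp))).elim
      · exact (hw (bad a e (by rw [← mul_assoc, haf]; simp [mul_assoc]))).elim
    · rw [hu2, hv2] at hw
      refine (hw (bad a a ?_)).elim
      rw [← WithOne.coe_mul, ← WithOne.coe_mul]
      congr 1
      rw [mul_assoc, ← hea, ← mul_assoc, hae]
  | bar u hu =>
    have hfac := h.isFactor_mul_self_bar (u.eval x)
    have hu' := hu fun hc => hw (hc.trans hfac.of_mul_left)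
    simp only [letters, eval] at hw ⊢
    rcases hu' with ⟨hu1, hu2 | hu2 | hu2⟩ | ⟨hu2, hu1⟩
    · exact Or.inl ⟨hu1, Or.inl (by rw [hu2, h.bar_of_idempotent he])⟩
    · exact Or.inl ⟨hu1, Or.inr (Or.inl (by rw [hu2, h.bar_of_idempotent hf]))⟩
    · refine (hw (IsFactor.trans ?_ hfac)).elim
      exact ⟨f, e, by rw [hu2]; simp [mul_assoc]⟩
    · refine (hw (IsFactor.trans ?_ hfac)).elim
      refine ⟨a, a, ?_⟩
      rw [hu2, ← WithOne.coe_mul, ← WithOne.coe_mul, ← WithOne.coe_mul]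
      congr 1
      rw [mul_assoc, ← hea, ← mul_assoc, hae]

/-- Under the assignment of `Word.eval_path`, x_1⋯x_n has the value a, so w does too. As q occurs in
w but not exactly once, ef must be a factor of a, hence of e = ba. -/
theorem regularClassesClosed_of_identity (h : BarLaws S) {n q : ℕ} {w : Word}
    (hw : ∀ x : ℕ → S, listEval x (List.range' 1 n) = ((w.eval x : S) : WithOne S))
    (hq1 : 1 ≤ q) (hqn : q ≤ n) (hq : q ∈ w.letters) (hcount : w.count q ≠ 1) :
    RegularClassesClosed (WithOne S) := by
  intro e f a b he hf hba hab hfa hae heb hbf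
  induction e using WithOne.recOneCoe with
  | one =>
    obtain ⟨rfl, rfl⟩ := WithOne.eq_one_of_mul_eq_one hba
    exact ⟨1, 1, by simp [← hab]⟩
  | coe e =>
  induction a using WithOne.recOneCoe with
  | one => simp at hae
  | coe a =>
  induction f using WithOne.recOneCoe with
  | one => exact absurd (WithOne.eq_one_of_mul_eq_one hab).1 (by simp)
  | coe f =>
  rw [← WithOne.coe_mul, WithOne.coe_inj] at he hf hfa hae
  set x : ℕ → S := fun m => if m < q then f else if m = q then a else e with hx
  have hlt : ∀ m < q, x m = f := fun m hm => by simp [hx, hm]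
  have heq : x q = a := by simp [hx]
  have hgt : ∀ m, q < m → x m = e := fun m hm => by simp [hx, hm.not_gt, hm.ne']
  have hpowf : ∀ m : ℕ, (f : WithOne S) ^ m * a = a := by
    intro m
    induction m with
    | zero => simp
    | succ m ih => rw [pow_succ, mul_assoc, ← WithOne.coe_mul, hfa, ih]
  have hpowe : ∀ m : ℕ, (a : WithOne S) * (e : WithOne S) ^ m = a := by
    intro m
    induction m with
    | zero => simp
    | succ m ih => rw [pow_succ', ← mul_assoc, ← WithOne.coe_mul, hae, ih]
  have hval : w.eval x = a := by
    apply WithOne.coe_injective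
    rw [← hw, listEval_range'_split x hq1 hqn, heq,
      listEval_const (a := f) (fun i hi => hlt i (by simp at hi; omega)),
      listEval_const (a := e) (fun i hi => hgt i (by simp at hi; omega)), hpowe, hpowf]
  by_cases hfac : IsFactor ((e * f : S) : WithOne S) (w.eval x : S)
  · rw [← WithOne.coe_mul, ← hba]
    rw [hval] at hfac
    exact hfac.trans ⟨b, 1, by simp⟩
  · rcases Word.eval_path h he hf hfa hae hlt heq hgt w hfac with h1 | h1
    · exact absurd hq h1.1
    · exact absurd h1.2 hcount

/-- A word in the letters of a completely regular word is a factor of that word. -/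
theorem Word.isFactor_of_letters_subset (h : BarLaws S)
    (hR : RegularClassesClosed (WithOne S)) {x : ℕ → S} {g : Word}
    (hg : IsCompletelyRegular ((g.eval x : S) : WithOne S)) {w : Word}
    (hw : w.letters ⊆ g.letters) :
    IsFactor ((w.eval x : S) : WithOne S) (g.eval x : S) := by
  have hletter : ∀ (v : Word) (i : ℕ), i ∈ v.letters →
      IsFactor (x i : WithOne S) (v.eval x : S) := by
    intro v i hi
    induction v with
    | letter m => cases hi; exact IsFactor.refl _
    | mul u v hu hv =>
      rcases hi with hi | hi
      · exact (hu hi).trans ⟨1, (v.eval x : S), by simp [eval]⟩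
      · exact (hv hi).trans ⟨(u.eval x : S), 1, by simp [eval]⟩
    | bar u hu => exact (hu hi).trans (h.isFactor_mul_self_bar (u.eval x)).of_mul_left
  induction w with
  | letter i => exact hletter g i (hw rfl)
  | mul u v hu hv =>
    simp only [eval, WithOne.coe_mul]
    exact (hu fun i hi => hw (Or.inl hi)).mul_of_completelyRegular h.hasDrazinInverses hR hg
      (hv fun i hi => hw (Or.inr hi))
  | bar u hu => exact h.isFactor_bar hR hg (hu hw)

end NonlinearIdentity

end EpigroupVarieties

namespace EpigroupVarieties

/-! ### Pumping a long semigroup identity to high powers of a letter. -/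

section Pumping

/-- Equality of products of letters as an identity of `S`. -/
def ListEquiv (S : Type u) [UnarySemigroup S] (l l' : List ℕ) : Prop :=
  ∀ x : ℕ → S, listEval x l = listEval x l'

/-- The sequence of blocks whose `m`-th term, for `1 ≤ m ≤ length`, is the `m`-th block. -/
def blockAt (T : List (List ℕ)) (m : ℕ) : List ℕ := T.getD (m - 1) [0]

/-- The list of one-letter blocks. -/
def singletons (l : List ℕ) : List (List ℕ) := l.map fun c => [c]

@[simp] theorem flatten_singletons (l : List ℕ) : (singletons l).flatten = l := by
  induction l with
  | nil => rfl
  | cons a l ih => simp_all [singletons]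

@[simp] theorem length_singletons (l : List ℕ) : (singletons l).length = l.length := by
  simp [singletons]

theorem nil_not_mem_singletons (l : List ℕ) : [] ∉ singletons l := by simp [singletons]

theorem blockAt_append_cons (T₁ T₂ : List (List ℕ)) (Y : List ℕ) {m : ℕ}
    (hm : m = T₁.length + 1) : blockAt (T₁ ++ Y :: T₂) m = Y := by
  subst hm
  simp [blockAt]

theorem flatMap_blockAt (T : List (List ℕ)) :
    (List.range' 1 T.length).flatMap (blockAt T) = T.flatten := by
  rw [List.flatMap_def]
  congr 1
  apply List.ext_getElem
  · simp
  · intro i h1 h2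
    simp [blockAt, h2]

theorem blockAt_ne_nil {T : List (List ℕ)} (hT : [] ∉ T) (m : ℕ) : blockAt T m ≠ [] := by
  unfold blockAt
  rcases lt_or_ge (m - 1) T.length with h | h
  · rw [List.getD_eq_getElem _ _ h]
    exact fun h0 => hT (h0 ▸ List.getElem_mem h)
  · rw [List.getD_eq_default _ _ h]; simp

theorem exists_append_of_le_length {α : Type*} {l : List α} {k : ℕ} (h : k ≤ l.length) :
    ∃ a b, l = a ++ b ∧ a.length = k :=
  ⟨l.take k, l.drop k, (List.take_append_drop k l).symm, by simp [h]⟩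

theorem exists_append_of_le_length' {α : Type*} {l : List α} {k : ℕ} (h : k ≤ l.length) :
    ∃ a b, l = a ++ b ∧ b.length = k :=
  ⟨l.take (l.length - k), l.drop (l.length - k), (List.take_append_drop _ l).symm,
    by simp; omega⟩

variable {S : Type u} [UnarySemigroup S]

theorem exists_coe_eq_listEval (x : ℕ → S) {l : List ℕ} (hl : l ≠ []) :
    ∃ a : S, (a : WithOne S) = listEval x l := by
  cases l with
  | nil => exact absurd rfl hl
  | cons i l =>
    refine ⟨(Word.mulLetterSeq (Word.letter i) l).eval x, ?_⟩
    rw [Word.coe_eval_mulLetterSeq, listEval_cons, Word.eval_letter]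

theorem ListEquiv.flatMap {l l' : List ℕ} (h : ListEquiv S l l') {t : ℕ → List ℕ}
    (ht : ∀ i, t i ≠ []) : ListEquiv S (l.flatMap t) (l'.flatMap t) := by
  intro x
  choose y hy using fun i => exists_coe_eq_listEval x (ht i)
  have key : ∀ m : List ℕ, listEval x (m.flatMap t) = listEval y m := by
    intro m
    induction m with
    | nil => simp
    | cons a m ih => simp [hy, ih]
  rw [key, key, h y]

theorem ListEquiv.blocks {n : ℕ} {w : List ℕ} (h : ListEquiv S (List.range' 1 n) w)
    {T : List (List ℕ)} (hT : [] ∉ T) (hn : T.length = n) :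
    ListEquiv S T.flatten (w.flatMap (blockAt T)) := by
  subst hn
  rw [← flatMap_blockAt]
  exact h.flatMap (blockAt_ne_nil hT)

theorem ListEquiv.trans_middle {p A B Y Z : List ℕ} (h : ListEquiv S p (A ++ (Y ++ B)))
    (h' : ListEquiv S Y Z) : ListEquiv S p (A ++ (Z ++ B)) := by
  intro x
  rw [h x]
  simp [h' x]

theorem length_le_flatMap {t : ℕ → List ℕ} (ht : ∀ i, t i ≠ []) (w : List ℕ) :
    w.length ≤ (w.flatMap t).length := by
  induction w with
  | nil => simp
  | cons a w ih =>
    have : 1 ≤ (t a).length := List.length_pos_iff.2 (ht a)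
    simp only [List.flatMap_cons, List.length_append, List.length_cons]
    omega

/-- Applying the identity to the first n letters of a word makes it strictly longer. -/
theorem ListEquiv.exists_long {n : ℕ} {w : List ℕ} (h : ListEquiv S (List.range' 1 n) w)
    (hw : n < w.length) (L : ℕ) :
    ∃ l, L ≤ l.length ∧ n ≤ l.length ∧ ListEquiv S (List.range' 1 n) l := by
  induction L with
  | zero => exact ⟨List.range' 1 n, by simp, by simp, fun _ => rfl⟩
  | succ L ih =>
    obtain ⟨l, hL, hn, hl⟩ := ih
    obtain ⟨a, b, rfl, ha⟩ := exists_append_of_le_length hn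
    have h1 := h.blocks (nil_not_mem_singletons a) (by simpa using ha)
    rw [flatten_singletons] at h1
    have h2 := length_le_flatMap (blockAt_ne_nil (nil_not_mem_singletons a)) w
    refine ⟨w.flatMap (blockAt (singletons a)) ++ b, ?_, ?_, ?_⟩
    · simp only [List.length_append] at hL ⊢; omega
    · simp only [List.length_append]; omega
    · exact ListEquiv.trans_middle (A := []) hl h1

/-- A block in position q is copied because q occurs twice in the right-hand side. Taking a'Xb' as
this block, with long a' and b', keeps the copies of X far from each other and from the ends. -/
theorem ListEquiv.duplicate {n q : ℕ} {w₁ w₂ w₃ p : List ℕ}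
    (h : ListEquiv S (List.range' 1 n) (w₁ ++ q :: (w₂ ++ q :: w₃)))
    (h1 : 1 ≤ q) (hqn : q ≤ n) {X A B : List ℕ} {L : ℕ} (hX : X ≠ [])
    (hA : 2 * L + n ≤ A.length) (hB : 2 * L + n ≤ B.length)
    (hp : ListEquiv S p (A ++ (X ++ B))) :
    ∃ A' σ B', L ≤ A'.length ∧ L ≤ σ.length ∧ L ≤ B'.length ∧
      ListEquiv S p (A' ++ (X ++ (σ ++ (X ++ B')))) := by
  obtain ⟨A₁, a', rfl, ha'⟩ := exists_append_of_le_length' (k := L) (l := A) (by omega)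
  simp only [List.length_append] at hA
  obtain ⟨A₀, a, rfl, ha⟩ := exists_append_of_le_length' (k := q - 1) (l := A₁) (by omega)
  obtain ⟨b', B₁, rfl, hb'⟩ := exists_append_of_le_length (k := L) (l := B) (by omega)
  simp only [List.length_append] at hB
  obtain ⟨b, B₀, rfl, hb⟩ := exists_append_of_le_length (k := n - q) (l := B₁) (by omega)
  simp only [List.length_append] at hA hB
  set T := singletons a ++ (a' ++ (X ++ b')) :: singletons b with hTdef
  have hT : [] ∉ T := by simp [hTdef, nil_not_mem_singletons, hX]
  have h2 := h.blocks hT (by simp [hTdef]; omega)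
  have hq : blockAt T q = a' ++ (X ++ b') := blockAt_append_cons _ _ _ (by simp; omega)
  simp only [List.flatMap_append, List.flatMap_cons, hq] at h2
  have hflat : T.flatten = a ++ (a' ++ (X ++ (b' ++ b))) := by simp [hTdef]
  rw [hflat] at h2
  have h3 : ListEquiv S p (A₀ ++ ((a ++ (a' ++ (X ++ (b' ++ b)))) ++ B₀)) := by
    simpa using hp
  have h4 := h3.trans_middle h2
  refine ⟨A₀ ++ (w₁.flatMap (blockAt T) ++ a'), b' ++ (w₂.flatMap (blockAt T) ++ a'),
    b' ++ (w₃.flatMap (blockAt T) ++ B₀), ?_, ?_, ?_, by simpa using h4⟩ <;>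
  · simp only [List.length_append]; omega

/-- The two copies of X are placed in the blocks substituted for x_i and x_j, so that the adjacent
pair of letters i, j brings them together. Were j = i + 1, there would be no block in between to
hold σ. -/
theorem ListEquiv.juxtapose {n i j : ℕ} {w₁ w₂ p : List ℕ}
    (h : ListEquiv S (List.range' 1 n) (w₁ ++ i :: j :: w₂))
    (hi : 1 ≤ i) (hin : i ≤ n) (hj : 1 ≤ j) (hjn : j ≤ n) (hij : j ≠ i + 1)
    {X A σ B : List ℕ} {L : ℕ} (hX : X ≠ [])
    (hA : L + n ≤ A.length) (hσ : L + n ≤ σ.length) (hB : L + n ≤ B.length)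
    (hp : ListEquiv S p (A ++ (X ++ (σ ++ (X ++ B))))) :
    ∃ A' B', L ≤ A'.length ∧ L ≤ B'.length ∧ ListEquiv S p (A' ++ ((X ++ X) ++ B')) := by
  obtain ⟨A₀, a, rfl, ha⟩ :=
    exists_append_of_le_length' (k := min i j - 1) (l := A) (by omega)
  obtain ⟨b, B₀, rfl, hb⟩ := exists_append_of_le_length (k := n - max i j) (l := B) (by omega)
  simp only [List.length_append] at hA hB
  have h3 : ListEquiv S p (A₀ ++ ((a ++ (X ++ (σ ++ (X ++ b)))) ++ B₀)) := by
    simpa using hp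
  rcases lt_trichotomy i j with hlt | rfl | hlt
  · rw [min_eq_left hlt.le] at ha
    rw [max_eq_right hlt.le] at hb
    -- Here j ≥ i + 2: of the j - i - 1 blocks between, the first j - i - 2 are single letters and
    -- the last one, s', takes the rest of σ.
    obtain ⟨s, s', rfl, hs⟩ :=
      exists_append_of_le_length (k := j - i - 2) (l := σ) (by omega)
    simp only [List.length_append] at hσ
    have hs' : s' ≠ [] := by rintro rfl; simp at hσ; omega
    set T := singletons a ++ X :: (singletons s ++ s' :: X :: singletons b) with hTdef
    have hT : [] ∉ T := by simp [hTdef, nil_not_mem_singletons, hX.symm, hs'.symm]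
    have h2 := h.blocks hT (by simp [hTdef]; omega)
    have hti : blockAt T i = X := blockAt_append_cons _ _ _ (by simp; omega)
    have htj : blockAt T j = X := by
      rw [show T = (singletons a ++ X :: (singletons s ++ [s'])) ++ X :: singletons b by
        simp [hTdef]]
      exact blockAt_append_cons _ _ _ (by simp; omega)
    simp only [List.flatMap_append, List.flatMap_cons, hti, htj] at h2
    have hflat : T.flatten = a ++ (X ++ ((s ++ s') ++ (X ++ b))) := by simp [hTdef]
    rw [hflat] at h2
    have h4 := h3.trans_middle h2
    refine ⟨A₀ ++ w₁.flatMap (blockAt T), w₂.flatMap (blockAt T) ++ B₀, ?_, ?_,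
      by simpa using h4⟩ <;>
    · simp only [List.length_append]; omega
  · simp only [min_self, max_self] at ha hb
    -- For i = j the one block XσX is squared, which puts its last X next to its first.
    set T := singletons a ++ (X ++ (σ ++ X)) :: singletons b with hTdef
    have hT : [] ∉ T := by simp [hTdef, nil_not_mem_singletons, hX]
    have h2 := h.blocks hT (by simp [hTdef]; omega)
    have hti : blockAt T i = X ++ (σ ++ X) := blockAt_append_cons _ _ _ (by simp; omega)
    simp only [List.flatMap_append, List.flatMap_cons, hti] at h2
    have hflat : T.flatten = a ++ (X ++ (σ ++ (X ++ b))) := by simp [hTdef]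
    rw [hflat] at h2
    have h4 := h3.trans_middle h2
    refine ⟨A₀ ++ (w₁.flatMap (blockAt T) ++ (X ++ σ)),
      σ ++ (X ++ (w₂.flatMap (blockAt T) ++ B₀)), ?_, ?_, by simpa using h4⟩ <;>
    · simp only [List.length_append]; omega
  · rw [min_eq_right hlt.le] at ha
    rw [max_eq_left hlt.le] at hb
    obtain ⟨s', s, rfl, hs⟩ :=
      exists_append_of_le_length' (k := i - j - 1) (l := σ) (by omega)
    simp only [List.length_append] at hσ
    -- For j < i the surplus s' of σ goes behind the X of block j, so blocks i and j in a row give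
    -- XXs'.
    set T := singletons a ++ (X ++ s') :: (singletons s ++ X :: singletons b) with hTdef
    have hT : [] ∉ T := by simp [hTdef, nil_not_mem_singletons, hX, hX.symm]
    have h2 := h.blocks hT (by simp [hTdef]; omega)
    have htj : blockAt T j = X ++ s' := blockAt_append_cons _ _ _ (by simp; omega)
    have hti : blockAt T i = X := by
      rw [show T = (singletons a ++ (X ++ s') :: singletons s) ++ X :: singletons b by
        simp [hTdef]]
      exact blockAt_append_cons _ _ _ (by simp; omega)
    simp only [List.flatMap_append, List.flatMap_cons, hti, htj] at h2
    have hflat : T.flatten = a ++ (X ++ ((s' ++ s) ++ (X ++ b))) := by simp [hTdef]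
    rw [hflat] at h2
    have h4 := h3.trans_middle h2
    refine ⟨A₀ ++ w₁.flatMap (blockAt T), s' ++ (w₂.flatMap (blockAt T) ++ B₀), ?_, ?_,
      by simpa using h4⟩ <;>
    · simp only [List.length_append]; omega

/-- The pigeonhole principle gives a repeated letter; a word whose neighbours were all consecutive
would increase strictly and have none. -/
theorem exists_repetition {n : ℕ} {w : List ℕ} (hw : n < w.length)
    (hmem : ∀ i ∈ w, 1 ≤ i ∧ i ≤ n) :
    (∃ q w₁ w₂ w₃, w = w₁ ++ q :: (w₂ ++ q :: w₃)) ∧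
      ∃ i j w₁ w₂, w = w₁ ++ i :: j :: w₂ ∧ j ≠ i + 1 := by
  have h1 : ¬ w.Nodup := by
    intro h
    have h2 : w.toFinset ⊆ Finset.Icc 1 n := fun i hi => by
      simpa using hmem i (by simpa using hi)
    have h3 := Finset.card_le_card h2
    rw [List.toFinset_card_of_nodup h] at h3
    simp at h3
    omega
  refine ⟨?_, ?_⟩
  · obtain ⟨q, hq⟩ := List.exists_duplicate_iff_not_nodup.2 h1
    rw [List.duplicate_iff_sublist, List.cons_sublist_iff] at hq
    obtain ⟨r₁, r₂, rfl, h2, h3⟩ := hq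
    rw [List.singleton_sublist] at h3
    obtain ⟨a, b, rfl⟩ := List.append_of_mem h2
    obtain ⟨c, d, rfl⟩ := List.append_of_mem h3
    exact ⟨q, a, b ++ c, d, by simp⟩
  · by_contra hcon
    push Not at hcon
    apply h1
    have h2 : w.IsChain fun i j => j = i + 1 := by
      rw [List.isChain_iff_forall_rel_of_append_cons_cons]
      intro a b l₁ l₂ h
      exact hcon a b l₁ l₂ h
    have h3 : w.IsChain (· < ·) := h2.imp fun a b h => by omega
    exact (List.isChain_iff_pairwise.1 h3).imp fun h => h.ne

theorem ListEquiv.exists_power {n : ℕ} {w : List ℕ} (h : ListEquiv S (List.range' 1 n) w)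
    (hw : n < w.length) (hmem : ∀ i ∈ w, 1 ≤ i ∧ i ≤ n) (k L : ℕ) :
    ∃ c A B, L ≤ A.length ∧ L ≤ B.length ∧
      ListEquiv S (List.range' 1 n) (A ++ (List.replicate (2 ^ k) c ++ B)) := by
  induction k generalizing L with
  | zero =>
    obtain ⟨l, hl, -, h1⟩ := h.exists_long hw (L + 1 + L)
    obtain ⟨A, B, rfl, hA⟩ := exists_append_of_le_length (k := L) (l := l) (by omega)
    cases B with
    | nil => simp at hl; omega
    | cons c B =>
      refine ⟨c, A, B, hA.ge, ?_, by simpa using h1⟩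
      simp only [List.length_append, List.length_cons] at hl
      omega
  | succ k ih =>
    -- This is the margin that `ListEquiv.duplicate` needs to leave L + n, which
    -- `ListEquiv.juxtapose` then reduces to L.
    obtain ⟨c, A, B, hA, hB, h1⟩ := ih (2 * (L + n) + n)
    obtain ⟨⟨q, w₁, w₂, w₃, hq⟩, i, j, v₁, v₂, hv, hij⟩ := exists_repetition hw hmem
    have hX : List.replicate (2 ^ k) c ≠ [] := by simp
    have hq' := hmem q (by simp [hq])
    have hi := hmem i (by simp [hv])
    have hj := hmem j (by simp [hv])
    obtain ⟨A', σ, B', hA', hσ, hB', h2⟩ :=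
      ListEquiv.duplicate (hq ▸ h) hq'.1 hq'.2 hX hA hB h1
    obtain ⟨A₂, B₂, hA₂, hB₂, h3⟩ :=
      ListEquiv.juxtapose (hv ▸ h) hi.1 hi.2 hj.1 hj.2 hij hX hA' hσ hB' h2
    refine ⟨c, A₂, B₂, hA₂, hB₂, ?_⟩
    rw [pow_succ, mul_two, List.replicate_add]
    exact h3

end Pumping

end EpigroupVarieties

namespace EpigroupVarieties

/-! ### Decomposition of words into atoms. -/

namespace Word

/-- Letters and words of the form `bar u`. -/
def IsAtom (w : Word) : Prop := (∃ i, w = letter i) ∨ ∃ u, w = bar u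

/-- The decomposition of a word into a product of atoms. -/
def atoms : Word → List Word
  | letter i => [letter i]
  | mul u v => atoms u ++ atoms v
  | bar u => [bar u]

theorem isAtom_of_mem_atoms {w y : Word} (h : y ∈ w.atoms) : y.IsAtom := by
  induction w with
  | letter i => simp only [atoms, List.mem_singleton] at h; exact Or.inl ⟨i, h⟩
  | mul u v hu hv =>
    simp only [atoms, List.mem_append] at h
    exact h.elim hu hv
  | bar u hu => simp only [atoms, List.mem_singleton] at h; exact Or.inr ⟨u, h⟩

theorem letters_subset_of_mem_atoms {w y : Word} (h : y ∈ w.atoms) : y.letters ⊆ w.letters := by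
  induction w with
  | letter i => simp only [atoms, List.mem_singleton] at h; rw [h]
  | mul u v hu hv =>
    simp only [atoms, List.mem_append] at h
    rcases h with h | h
    · exact (hu h).trans Set.subset_union_left
    · exact (hv h).trans Set.subset_union_right
  | bar u hu => simp only [atoms, List.mem_singleton] at h; rw [h]

theorem length_of_atoms_eq {w : Word} {l : List ℕ} (h : w.atoms = l.map letter) :
    w.length = l.length := by
  induction w generalizing l with
  | letter i =>
    have := congrArg List.length h
    simp only [atoms, List.length_map, List.length_singleton] at this
    simp [length, ← this]
  | mul u v hu hv =>
    simp only [atoms] at h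
    obtain ⟨a, b, rfl, h1, h2⟩ := List.map_eq_append_iff.1 h.symm
    simp [length, hu h1.symm, hv h2.symm]
  | bar u hu =>
    simp only [atoms] at h
    cases l with
    | nil => simp at h
    | cons a l => simp at h

theorem exists_eq_map_letter {L : List Word} (h : ∀ y ∈ L, ∃ i, y = letter i) :
    ∃ l : List ℕ, L = l.map letter := by
  induction L with
  | nil => exact ⟨[], rfl⟩
  | cons a L ih =>
    obtain ⟨l, rfl⟩ := ih fun y hy => h y (List.mem_cons_of_mem _ hy)
    obtain ⟨i, rfl⟩ := h a List.mem_cons_self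
    exact ⟨i :: l, rfl⟩

/-- The product of the words in `A`, of `g`, and of the words in `B`. -/
def insertBetween (A : List Word) (g : Word) (B : List Word) : Word :=
  A.foldr (· * ·) (B.foldl (· * ·) g)

variable {S : Type u} [UnarySemigroup S]

theorem wordsEval_atoms (x : ℕ → S) (w : Word) :
    wordsEval x w.atoms = ((w.eval x : S) : WithOne S) := by
  induction w with
  | letter i => simp [atoms]
  | mul u v hu hv => simp [atoms, hu, hv, eval]
  | bar u hu => simp [atoms]

theorem coe_eval_insertBetween (x : ℕ → S) (A : List Word) (g : Word) (B : List Word) :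
    (((insertBetween A g B).eval x : S) : WithOne S) =
      wordsEval x A * (g.eval x : S) * wordsEval x B := by
  have h1 : ∀ (B : List Word) (g : Word), (((B.foldl (· * ·) g).eval x : S) : WithOne S) =
      (g.eval x : S) * wordsEval x B := by
    intro B
    induction B with
    | nil => intro g; simp
    | cons b B ih => intro g; rw [List.foldl_cons, ih, eval_mul]; simp [mul_assoc]
  unfold insertBetween
  induction A with
  | nil => simp [h1]
  | cons a A ih => rw [List.foldr_cons, eval_mul, WithOne.coe_mul, ih]; simp [mul_assoc]

theorem letters_insertBetween (A : List Word) (g : Word) (B : List Word) :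
    (insertBetween A g B).letters = {i | ∃ w ∈ A ++ g :: B, i ∈ w.letters} := by
  have h1 : ∀ (B : List Word) (g : Word), (B.foldl (· * ·) g).letters =
      {i | ∃ w ∈ g :: B, i ∈ w.letters} := by
    intro B
    induction B with
    | nil => intro g; simp
    | cons b B ih =>
      intro g
      rw [List.foldl_cons, ih]
      ext i
      change (∃ w ∈ (g * b) :: B, i ∈ w.letters) ↔ _
      have : ∀ i, i ∈ (g * b).letters ↔ i ∈ g.letters ∨ i ∈ b.letters := fun i => Iff.rfl
      simp [this, or_assoc]
  unfold insertBetween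
  induction A with
  | nil => simp [h1]
  | cons a A ih =>
    ext i
    have : ∀ v, i ∈ (a * v).letters ↔ i ∈ a.letters ∨ i ∈ v.letters := fun v => Iff.rfl
    rw [List.foldr_cons, this, ih]
    simp

theorem count_insertBetween_bar {q : ℕ} (A : List Word) {g : Word} (B : List Word)
    (hq : q ∈ g.letters) : (insertBetween A (bar g) B).count q = ⊤ := by
  have h1 : ∀ (B : List Word) (g : Word), g.count q = ⊤ →
      (B.foldl (· * ·) g).count q = ⊤ := by
    intro B
    induction B with
    | nil => exact fun g h => h
    | cons b B ih =>
      intro g hg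
      refine ih _ ?_
      change g.count q + b.count q = ⊤
      rw [hg, top_add]
  unfold insertBetween
  induction A with
  | nil => exact h1 B _ (by simp [count, hq])
  | cons a A ih =>
    rw [List.foldr_cons]
    change a.count q + count q _ = ⊤
    rw [ih, add_top]

end Word

/-! ### Existence of regular factorizations. -/

section Factorization

/-- An identity `x_1 ⋯ x_n = U · g · W`, where `U` and `W` are products of atoms, `g` takes
values in subgroups, and only the letters `x_1, …, x_n` occur. -/
structure RegularFactorization (S : Type u) [UnarySemigroup S] (n : ℕ) where
  left : List Word
  core : Word
  right : List Word
  eval_eq : ∀ x : ℕ → S, listEval x (List.range' 1 n) =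
    wordsEval x left * (core.eval x : S) * wordsEval x right
  regular : ∀ x : ℕ → S, IsCompletelyRegular ((core.eval x : S) : WithOne S)
  letters_left : ∀ y ∈ left, y.letters ⊆ Set.Icc 1 n
  letters_core : core.letters ⊆ Set.Icc 1 n
  letters_right : ∀ y ∈ right, y.letters ⊆ Set.Icc 1 n
  atom_left : ∀ y ∈ left, y.IsAtom
  atom_right : ∀ y ∈ right, y.IsAtom

variable {S : Type u} [UnarySemigroup S] {n : ℕ}

/-- The letter `x_i`, if `1 ≤ i ≤ n`, and `x_1` otherwise. -/
def foldLetter (n i : ℕ) : Word := Word.letter (if 1 ≤ i ∧ i ≤ n then i else 1)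

theorem letters_subst_foldLetter (hn : 1 ≤ n) (w : Word) :
    (w.subst (foldLetter n)).letters ⊆ Set.Icc 1 n := by
  rw [Word.letters_subst]
  refine Set.iUnion₂_subset fun i _ => ?_
  unfold foldLetter
  split_ifs with h
  · exact Set.singleton_subset_iff.2 h
  · exact Set.singleton_subset_iff.2 ⟨le_rfl, hn⟩

theorem length_subst_foldLetter (w : Word) : (w.subst (foldLetter n)).length = w.length := by
  induction w with
  | letter i => rfl
  | mul u v hu hv => simp [Word.subst, Word.length, hu, hv]
  | bar u hu => rfl

theorem Word.IsAtom.subst_foldLetter {w : Word} (hw : w.IsAtom) :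
    (w.subst (foldLetter n)).IsAtom := by
  rcases hw with ⟨i, rfl⟩ | ⟨u, rfl⟩
  · exact Or.inl ⟨_, rfl⟩
  · exact Or.inr ⟨_, rfl⟩

theorem listEval_foldLetter (x : ℕ → S) :
    listEval (fun i => (foldLetter n i).eval x) (List.range' 1 n) =
      listEval x (List.range' 1 n) := by
  refine listEval_congr fun i hi => ?_
  rw [List.mem_range'_1] at hi
  rw [foldLetter, if_pos (by omega), Word.eval_letter]

/-- Letters beyond x_1, …, x_n do not affect the left-hand side, so they may all be replaced by x_1.
-/
theorem RegularFactorization.nonempty_of_eval_eq (hn : 1 ≤ n) {U W : List Word} {g : Word}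
    (heq : ∀ x : ℕ → S, listEval x (List.range' 1 n) =
      wordsEval x U * (g.eval x : S) * wordsEval x W)
    (hg : ∀ x : ℕ → S, IsCompletelyRegular ((g.eval x : S) : WithOne S))
    (hU : ∀ y ∈ U, y.IsAtom) (hW : ∀ y ∈ W, y.IsAtom) :
    Nonempty (RegularFactorization S n) := by
  refine ⟨⟨U.map (Word.subst (foldLetter n)), g.subst (foldLetter n),
    W.map (Word.subst (foldLetter n)), fun x => ?_, fun x => ?_, ?_,
    letters_subst_foldLetter hn g, ?_, ?_, ?_⟩⟩
  · rw [wordsEval_map_subst, wordsEval_map_subst, Word.eval_subst, ← heq, listEval_foldLetter]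
  · rw [Word.eval_subst]; exact hg _
  · intro y hy
    obtain ⟨z, -, rfl⟩ := List.mem_map.1 hy
    exact letters_subst_foldLetter hn z
  · intro y hy
    obtain ⟨z, -, rfl⟩ := List.mem_map.1 hy
    exact letters_subst_foldLetter hn z
  · intro y hy
    obtain ⟨z, hz, rfl⟩ := List.mem_map.1 hy
    exact (hU z hz).subst_foldLetter
  · intro y hy
    obtain ⟨z, hz, rfl⟩ := List.mem_map.1 hy
    exact (hW z hz).subst_foldLetter

theorem isAtom_of_mem_map_letter {l : List ℕ} : ∀ y ∈ l.map Word.letter, y.IsAtom := by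
  intro y hy
  obtain ⟨i, -, rfl⟩ := List.mem_map.1 hy
  exact Or.inl ⟨i, rfl⟩

/-- A barred atom serves as the core. If there is none, pumping yields a power of a letter, and the
uniform bound N on the index makes its (N+1)-st power completely regular. -/
theorem RegularFactorization.nonempty_of_identity (h : BarLaws S) (hn : 1 ≤ n) {N : ℕ}
    (hN : ∀ a : S,
      (a : WithOne S) ^ (N + 1) * a * (UnarySemigroup.bar a : S) = (a : WithOne S) ^ (N + 1))
    {w : Word} (hw : (n : ℕ∞) < w.length)
    (heq : ∀ x : ℕ → S, listEval x (List.range' 1 n) = ((w.eval x : S) : WithOne S)) :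
    Nonempty (RegularFactorization S n) := by
  set v := w.subst (foldLetter n) with hv
  have hveq : ∀ x : ℕ → S, listEval x (List.range' 1 n) = wordsEval x v.atoms := by
    intro x
    rw [Word.wordsEval_atoms, hv, Word.eval_subst, ← heq, listEval_foldLetter]
  by_cases hbar : ∃ u, Word.bar u ∈ v.atoms
  · obtain ⟨u, hu⟩ := hbar
    obtain ⟨U, W, hUW⟩ := List.append_of_mem hu
    refine nonempty_of_eval_eq hn (U := U) (W := W) (g := Word.bar u) ?_
      (fun x => h.isCompletelyRegular_bar _) ?_ ?_
    · intro x; rw [hveq, hUW]; simp [mul_assoc]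
    · exact fun y hy => Word.isAtom_of_mem_atoms (w := v) (by rw [hUW]; simp [hy])
    · exact fun y hy => Word.isAtom_of_mem_atoms (w := v) (by rw [hUW]; simp [hy])
  · obtain ⟨l, hl⟩ : ∃ l : List ℕ, v.atoms = l.map Word.letter := by
      refine Word.exists_eq_map_letter fun y hy => ?_
      rcases Word.isAtom_of_mem_atoms hy with hy' | ⟨u, rfl⟩
      · exact hy'
      · exact absurd ⟨u, hy⟩ hbar
    have hlen : n < l.length := by
      rw [← length_subst_foldLetter (n := n), ← hv, Word.length_of_atoms_eq hl] at hw
      exact_mod_cast hw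
    have hmem : ∀ i ∈ l, 1 ≤ i ∧ i ≤ n := by
      intro i hi
      have h1 : Word.letter i ∈ v.atoms := by rw [hl]; exact List.mem_map_of_mem hi
      exact letters_subst_foldLetter hn w (Word.letters_subset_of_mem_atoms h1 rfl)
    have hequiv : ListEquiv S (List.range' 1 n) l := by
      intro x; rw [hveq, hl, wordsEval_map_letter]
    obtain ⟨c, A, B, -, -, h1⟩ := hequiv.exists_power hlen hmem (N + 1) 0
    -- Only N + 1 copies of c form the core; the other r move to the right part.
    obtain ⟨r, hr⟩ : ∃ r, 2 ^ (N + 1) = N + 1 + r :=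
      ⟨2 ^ (N + 1) - (N + 1), by have := (N + 1).lt_two_pow_self; omega⟩
    have hg : ∀ x : ℕ → S,
        (((Word.mulLetterSeq (Word.letter c) (List.replicate N c)).eval x : S) : WithOne S) =
          (x c : WithOne S) ^ (N + 1) := by
      intro x
      rw [Word.coe_eval_mulLetterSeq, Word.eval_letter, pow_succ',
        listEval_const (a := x c) fun i hi => by rw [List.eq_of_mem_replicate hi],
        List.length_replicate]
    refine nonempty_of_eval_eq hn (U := A.map Word.letter)
      (W := (List.replicate r c ++ B).map Word.letter)
      (g := Word.mulLetterSeq (Word.letter c) (List.replicate N c)) ?_ ?_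
      isAtom_of_mem_map_letter isAtom_of_mem_map_letter
    · intro x
      rw [h1, hr, List.replicate_add, hg, wordsEval_map_letter, wordsEval_map_letter]
      simp only [listEval_append]
      rw [listEval_const (l := List.replicate (N + 1) c) (a := x c)
        fun i hi => by rw [List.eq_of_mem_replicate hi], List.length_replicate]
      simp only [mul_assoc]
    · intro x
      rw [hg]
      exact isCompletelyRegular_pow (by exact_mod_cast congrArg WithOne.coe (h.mul_bar (x c)))
        (hN _)

/-- Doubly barring the core does not change its value but makes the count of each of its letters
infinite. -/
theorem RegularFactorization.regularClassesClosed (h : BarLaws S)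
    (D : RegularFactorization S n) : RegularClassesClosed (WithOne S) := by
  obtain ⟨q, hq⟩ := D.core.letters_nonempty
  obtain ⟨h1, h2⟩ := D.letters_core hq
  refine regularClassesClosed_of_identity h (n := n) (q := q)
    (w := Word.insertBetween D.left (Word.bar (Word.bar D.core)) D.right) ?_ h1 h2 ?_ ?_
  · intro x
    rw [Word.coe_eval_insertBetween, D.eval_eq, Word.eval_bar, Word.eval_bar, h.bar_bar,
      WithOne.coe_mul, WithOne.coe_mul, h.mul_mul_bar_of_isCompletelyRegular (D.regular x)]
  · rw [Word.letters_insertBetween]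
    exact ⟨Word.bar (Word.bar D.core), by simp, hq⟩
  · rw [Word.count_insertBetween_bar _ _ (by exact hq)]
    simp

end Factorization

end EpigroupVarieties

namespace EpigroupVarieties

/-! ### Optimal factorizations. -/

namespace RegularFactorization

variable {S : Type u} [UnarySemigroup S] {n : ℕ}

theorem letters_finite (D : RegularFactorization S n) : D.core.letters.Finite :=
  D.core.letters_finite

theorem ncard_letters_le (D : RegularFactorization S n) : D.core.letters.ncard ≤ n := by
  have h := Set.ncard_le_ncard D.letters_core (Set.finite_Icc 1 n)
  rwa [← Finset.coe_Icc, Set.ncard_coe_finset, Nat.card_Icc, Nat.add_sub_cancel] at h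

/-- The core has as many letters as possible and, among such factorizations, the number of
factors is least possible. -/
def IsOptimal (D : RegularFactorization S n) : Prop :=
  ∀ D' : RegularFactorization S n, D'.core.letters.ncard ≤ D.core.letters.ncard ∧
    (D'.core.letters.ncard = D.core.letters.ncard →
      D.left.length + D.right.length ≤ D'.left.length + D'.right.length)

theorem exists_isOptimal (h : Nonempty (RegularFactorization S n)) :
    ∃ D : RegularFactorization S n, D.IsOptimal := by
  let f : RegularFactorization S n → ℕ ×ₗ ℕ := fun D =>
    toLex (n - D.core.letters.ncard, D.left.length + D.right.length)
  obtain ⟨D, -, hD⟩ := (InvImage.wf f (wellFounded_lt (α := ℕ ×ₗ ℕ))).has_min Set.univ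
    ⟨h.some, trivial⟩
  refine ⟨D, fun D' => ?_⟩
  have h1 := hD D' trivial
  have h2 := D.ncard_letters_le
  have h3 := D'.ncard_letters_le
  simp only [InvImage, f, Prod.Lex.toLex_lt_toLex, not_or, not_and, not_lt] at h1
  exact ⟨by omega, fun h4 => h1.2 (by rw [h4])⟩

/-- Substitution in an inner factor of `x_1 ⋯ x_n`. -/
theorem IsOptimal.letters_subset {D : RegularFactorization S n} (hD : D.IsOptimal)
    {A T B : List Word} {k : ℕ} {t : Word} (hT : T.length = n)
    (heq : ∀ x : ℕ → S, listEval x (List.range' 1 n) =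
      wordsEval x A * wordsEval x T * wordsEval x B)
    (hA : ∀ y ∈ A, y.letters ⊆ Set.Icc 1 n) (hTl : ∀ y ∈ T, y.letters ⊆ Set.Icc 1 n)
    (hB : ∀ y ∈ B, y.letters ⊆ Set.Icc 1 n)
    (hA' : ∀ y ∈ A, y.IsAtom) (hB' : ∀ y ∈ B, y.IsAtom)
    (hk : k + 1 ∈ D.core.letters) (ht : T[k]? = some t) (hsub : D.core.letters ⊆ t.letters) :
    t.letters ⊆ D.core.letters := by
  have hn : 1 ≤ n := le_trans (D.letters_core hk).1 (D.letters_core hk).2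
  set σ : ℕ → Word := fun m => T.getD (m - 1) (Word.letter 1) with hσ
  have hσl : ∀ m, (σ m).letters ⊆ Set.Icc 1 n := by
    intro m
    simp only [hσ]
    rcases lt_or_ge (m - 1) T.length with h | h
    · rw [List.getD_eq_getElem _ _ h]
      exact hTl _ (List.getElem_mem h)
    · rw [List.getD_eq_default _ _ h]
      exact Set.singleton_subset_iff.2 ⟨le_rfl, hn⟩
  have hσT : ∀ x : ℕ → S, wordsEval x T =
      listEval (fun m => (σ m).eval x) (List.range' 1 n) := by
    intro x
    unfold wordsEval listEval
    congr 1
    apply List.ext_getElem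
    · simp [hT]
    · intro i h1 h2
      simp only [List.length_map] at h1
      simp [hσ, h1]
  have hsubst : ∀ w : Word, (w.subst σ).letters ⊆ Set.Icc 1 n := by
    intro w
    rw [Word.letters_subst]
    exact Set.iUnion₂_subset fun i _ => hσl i
  have hatoms : ∀ L : List Word, ∀ y ∈ (L.map (Word.subst σ)).flatMap Word.atoms,
      y.letters ⊆ Set.Icc 1 n ∧ y.IsAtom := by
    intro L y hy
    obtain ⟨z, hz, hyz⟩ := List.mem_flatMap.1 hy
    obtain ⟨z', -, rfl⟩ := List.mem_map.1 hz
    exact ⟨(Word.letters_subset_of_mem_atoms hyz).trans (hsubst z'),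
      Word.isAtom_of_mem_atoms hyz⟩
  have heval : ∀ (L : List Word) (x : ℕ → S),
      wordsEval x ((L.map (Word.subst σ)).flatMap Word.atoms) =
        wordsEval (fun m => (σ m).eval x) L := by
    intro L x
    rw [← wordsEval_map_subst]
    induction L.map (Word.subst σ) with
    | nil => simp
    | cons a L ih => simp [ih, Word.wordsEval_atoms]
  -- The identity is applied to its own factor T. Since x_{k+1} occurs in the core, the new core
  -- contains all letters of t, and maximality leaves no room for more letters than before.
  let D' : RegularFactorization S n :=
    { left := A ++ (D.left.map (Word.subst σ)).flatMap Word.atoms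
      core := D.core.subst σ
      right := (D.right.map (Word.subst σ)).flatMap Word.atoms ++ B
      eval_eq := fun x => by
        rw [heq, hσT, D.eval_eq, wordsEval_append, wordsEval_append, heval, heval,
          Word.eval_subst]
        simp only [mul_assoc]
      regular := fun x => by rw [Word.eval_subst]; exact D.regular _
      letters_left := fun y hy => (List.mem_append.1 hy).elim (hA y) fun h => (hatoms _ y h).1
      letters_core := hsubst _
      letters_right := fun y hy => (List.mem_append.1 hy).elim (fun h => (hatoms _ y h).1) (hB y)
      atom_left := fun y hy => (List.mem_append.1 hy).elim (hA' y) fun h => (hatoms _ y h).2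
      atom_right := fun y hy => (List.mem_append.1 hy).elim (fun h => (hatoms _ y h).2) (hB' y) }
  have htD' : t.letters ⊆ D'.core.letters := by
    change _ ⊆ (D.core.subst σ).letters
    rw [Word.letters_subst]
    have : σ (k + 1) = t := by simp [hσ, List.getD_eq_getElem?_getD, ht]
    rw [← this]
    exact Set.subset_iUnion₂_of_subset (k + 1) hk subset_rfl
  have hEq := Set.eq_of_subset_of_ncard_le (hsub.trans htD') (hD D').1 D'.letters_finite
  rw [hEq]
  exact htD'

/-- A word that acts as a unit on the core. -/
def unitWord (g : Word) : Word := Word.bar g * g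

theorem mul_unitWord (h : BarLaws S) (D : RegularFactorization S n) (x : ℕ → S) (k : ℕ) :
    ((D.core.eval x : S) : WithOne S) * wordsEval x (List.replicate k (unitWord D.core)) =
        (D.core.eval x : S) ∧
      wordsEval x (List.replicate k (unitWord D.core)) * (D.core.eval x : S) =
        (D.core.eval x : S) := by
  have h1 := h.mul_mul_bar_of_isCompletelyRegular (D.regular x)
  have h2 : (((unitWord D.core).eval x : S) : WithOne S) =
      (UnarySemigroup.bar (D.core.eval x) : S) * (D.core.eval x : S) := rfl
  have h3 : ((D.core.eval x : S) : WithOne S) * (UnarySemigroup.bar (D.core.eval x) : S) =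
      (UnarySemigroup.bar (D.core.eval x) : S) * (D.core.eval x : S) := by
    exact_mod_cast congrArg WithOne.coe (h.mul_bar (D.core.eval x))
  induction k with
  | zero => simp
  | succ k ih =>
    constructor
    · rw [List.replicate_succ, wordsEval_cons, h2, ← h3, ← mul_assoc, ← mul_assoc, h1, ih.1]
    · rw [List.replicate_succ, wordsEval_cons, mul_assoc, ih.2, h2, ← h3, mul_assoc, ← h3,
        ← mul_assoc, h1]

theorem letters_unitWord (g : Word) : (unitWord g).letters = g.letters :=
  Set.union_self _

/-- Otherwise Y·y·core can be cut into n pieces with y and the core together in the j-th; optimality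
forces the letters of y into the core, which can then absorb y. Allowing any Y with the same product
covers artificially lengthened left parts. -/
theorem IsOptimal.length_left_lt (h : BarLaws S) {D : RegularFactorization S n}
    (hD : D.IsOptimal) {U Y : List Word} {y : Word} (hU : D.left = U ++ [y])
    (hY : ∀ x : ℕ → S, wordsEval x (Y ++ [y]) = wordsEval x D.left)
    (hYl : ∀ z ∈ Y, z.letters ⊆ Set.Icc 1 n) {j : ℕ} (hj : j ∈ D.core.letters) :
    Y.length + 1 < j := by
  by_contra hlt
  obtain ⟨hj1, hjn⟩ := D.letters_core hj
  have hyl : y.letters ⊆ Set.Icc 1 n := D.letters_left y (by simp [hU])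
  obtain ⟨Y₁, Y₂, rfl, hY₁⟩ := exists_append_of_le_length (l := Y) (k := j - 1) (by omega)
  have hletters : (Word.insertBetween Y₂ y [D.core]).letters =
      {i | (∃ w ∈ Y₂, i ∈ w.letters) ∨ i ∈ y.letters ∨ i ∈ D.core.letters} := by
    rw [Word.letters_insertBetween]
    ext i
    simp [or_and_right, exists_or]
  have hsub : y.letters ⊆ D.core.letters := by
    -- The pieces are j - 1 factors of Y, the rest up to the core as one word, and n - j copies of
    -- the local unit of the core.
    refine Set.Subset.trans ?_ (hD.letters_subset (A := []) (B := D.right)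
      (T := Y₁ ++ Word.insertBetween Y₂ y [D.core] ::
        List.replicate (n - j) (unitWord D.core)) (k := j - 1)
      (t := Word.insertBetween Y₂ y [D.core]) ?_ ?_ (by simp) ?_ D.letters_right (by simp)
      D.atom_right (by rwa [Nat.sub_add_cancel hj1]) ?_ ?_)
    · rw [hletters]; exact fun i hi => Or.inr (Or.inl hi)
    · simp; omega
    · intro x
      have h1 := hY x
      have h2 := (mul_unitWord h D x (n - j)).1
      simp only [wordsEval_append, wordsEval_cons, wordsEval_nil, mul_one] at h1
      rw [D.eval_eq, ← h1]
      simp only [wordsEval_append, wordsEval_cons, wordsEval_nil, mul_one, one_mul,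
        Word.coe_eval_insertBetween, mul_assoc]
      rw [← mul_assoc _ (wordsEval x (List.replicate _ _)), h2]
    · intro z hz
      simp only [List.mem_append, List.mem_cons, List.mem_replicate] at hz
      rcases hz with hz | rfl | ⟨-, rfl⟩
      · exact hYl z (by simp [hz])
      · rw [hletters]
        rintro i (⟨w, hw, hi⟩ | hi | hi)
        · exact hYl w (by simp [hw]) hi
        · exact hyl hi
        · exact D.letters_core hi
      · rw [letters_unitWord]; exact D.letters_core
    · rw [← hY₁]; simp
    · rw [hletters]; exact fun i hi => Or.inr (Or.inr hi)
  have hR := D.regularClassesClosed h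
  have hlet : (y * D.core).letters = D.core.letters := Set.union_eq_self_of_subset_left hsub
  let D' : RegularFactorization S n :=
    { left := U
      core := y * D.core
      right := D.right
      eval_eq := fun x => by
        rw [D.eval_eq, hU]; simp [Word.eval_mul, mul_assoc]
      regular := fun x => by
        rw [Word.eval_mul, WithOne.coe_mul]
        exact ((D.regular x).mul_factor h.hasDrazinInverses hR
          (Word.isFactor_of_letters_subset h hR (D.regular x) hsub)).1.1
      letters_left := fun z hz => D.letters_left z (by simp [hU, hz])
      letters_core := by rw [hlet]; exact D.letters_core
      letters_right := D.letters_right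
      atom_left := fun z hz => D.atom_left z (by simp [hU, hz])
      atom_right := D.atom_right }
  have h3 := (hD D').2 (congrArg Set.ncard hlet)
  have h4 : D.left.length = U.length + 1 := by rw [hU]; simp
  change _ ≤ U.length + D.right.length at h3
  omega

/-- Mirror image of `IsOptimal.length_left_lt`; the local units now fill the first j - 1 positions.
-/
theorem IsOptimal.length_right_lt (h : BarLaws S) {D : RegularFactorization S n}
    (hD : D.IsOptimal) {W Y : List Word} {y : Word} (hW : D.right = y :: W)
    (hY : ∀ x : ℕ → S, wordsEval x (y :: Y) = wordsEval x D.right)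
    (hYl : ∀ z ∈ Y, z.letters ⊆ Set.Icc 1 n) {j : ℕ} (hj : j ∈ D.core.letters) :
    Y.length + 1 < n + 1 - j := by
  by_contra hlt
  obtain ⟨hj1, hjn⟩ := D.letters_core hj
  have hyl : y.letters ⊆ Set.Icc 1 n := D.letters_right y (by simp [hW])
  obtain ⟨Y₂, Y₁, rfl, hY₁⟩ := exists_append_of_le_length' (l := Y) (k := n - j) (by omega)
  have hletters : (Word.insertBetween [D.core] y Y₂).letters =
      {i | (∃ w ∈ Y₂, i ∈ w.letters) ∨ i ∈ y.letters ∨ i ∈ D.core.letters} := by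
    rw [Word.letters_insertBetween]
    ext i
    simp only [List.singleton_append, List.mem_cons, Set.mem_ofPred_eq, or_and_right, exists_or,
      exists_eq_left]
    constructor
    · rintro (hi | hi | hi)
      exacts [Or.inr (Or.inr hi), Or.inr (Or.inl hi), Or.inl hi]
    · rintro (hi | hi | hi)
      exacts [Or.inr (Or.inr hi), Or.inr (Or.inl hi), Or.inl hi]
  have hsub : y.letters ⊆ D.core.letters := by
    refine Set.Subset.trans ?_ (hD.letters_subset (A := D.left) (B := [])
      (T := List.replicate (j - 1) (unitWord D.core) ++
        Word.insertBetween [D.core] y Y₂ :: Y₁) (k := j - 1)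
      (t := Word.insertBetween [D.core] y Y₂) ?_ ?_ D.letters_left ?_ (by simp)
      D.atom_left (by simp) (by rwa [Nat.sub_add_cancel hj1]) ?_ ?_)
    · rw [hletters]; exact fun i hi => Or.inr (Or.inl hi)
    · simp; omega
    · intro x
      have h1 := hY x
      have h2 := (mul_unitWord h D x (j - 1)).2
      simp only [wordsEval_append, wordsEval_cons] at h1
      rw [D.eval_eq, ← h1]
      simp only [wordsEval_append, wordsEval_cons, wordsEval_nil, mul_one,
        Word.coe_eval_insertBetween, mul_assoc]
      rw [← mul_assoc (wordsEval x (List.replicate _ _)), h2]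
    · intro z hz
      simp only [List.mem_append, List.mem_cons, List.mem_replicate] at hz
      rcases hz with ⟨-, rfl⟩ | rfl | hz
      · rw [letters_unitWord]; exact D.letters_core
      · rw [hletters]
        rintro i (⟨w, hw, hi⟩ | hi | hi)
        · exact hYl w (by simp [hw]) hi
        · exact hyl hi
        · exact D.letters_core hi
      · exact hYl z (by simp [hz])
    · simp
    · rw [hletters]; exact fun i hi => Or.inr (Or.inr hi)
  have hR := D.regularClassesClosed h
  have hlet : (D.core * y).letters = D.core.letters := Set.union_eq_self_of_subset_right hsub
  let D' : RegularFactorization S n :=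
    { left := D.left
      core := D.core * y
      right := W
      eval_eq := fun x => by
        rw [D.eval_eq, hW]; simp [Word.eval_mul, mul_assoc]
      regular := fun x => by
        rw [Word.eval_mul, WithOne.coe_mul]
        exact ((D.regular x).mul_factor h.hasDrazinInverses hR
          (Word.isFactor_of_letters_subset h hR (D.regular x) hsub)).2.1
      letters_left := D.letters_left
      letters_core := by rw [hlet]; exact D.letters_core
      letters_right := fun z hz => D.letters_right z (by simp [hW, hz])
      atom_left := D.atom_left
      atom_right := fun z hz => D.atom_right z (by simp [hW, hz]) }
  have h3 := (hD D').2 (congrArg Set.ncard hlet)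
  have h4 : D.right.length = W.length + 1 := by rw [hW]; simp
  change _ ≤ D.left.length + W.length at h3
  omega

/-- This allows a product with a barred factor to be stretched to any length. -/
theorem wordsEval_bar_split (h : BarLaws S) (u : Word) (x : ℕ → S) (k : ℕ) :
    wordsEval x (List.replicate k (Word.bar u * u)) * ((Word.bar u).eval x : S) =
        ((Word.bar u).eval x : S) ∧
      (((Word.bar u).eval x : S) : WithOne S) * wordsEval x (List.replicate k (u * Word.bar u)) =
        ((Word.bar u).eval x : S) := by
  have h1 : (((Word.bar u * u : Word).eval x : S) : WithOne S) * ((Word.bar u).eval x : S) =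
      ((Word.bar u).eval x : S) := by
    rw [← WithOne.coe_mul]
    exact congrArg WithOne.coe (h.bar_mul_bar (u.eval x))
  have h2 : (((Word.bar u).eval x : S) : WithOne S) * ((u * Word.bar u : Word).eval x : S) =
      ((Word.bar u).eval x : S) := by
    rw [← WithOne.coe_mul]
    refine congrArg WithOne.coe (Eq.trans ?_ (h.bar_mul_bar (u.eval x)))
    rw [mul_assoc]; rfl
  induction k with
  | zero => simp
  | succ k ih =>
    constructor
    · rw [List.replicate_succ, wordsEval_cons, mul_assoc, ih.1, h1]
    · rw [List.replicate_succ, wordsEval_cons, ← mul_assoc, h2, ih.2]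

/-- A barred factor could be stretched by n further factors, exceeding the bound of
`IsOptimal.length_left_lt`. -/
theorem IsOptimal.left_eq_map_letter (h : BarLaws S) {D : RegularFactorization S n}
    (hD : D.IsOptimal) : ∃ l : List ℕ, D.left = l.map Word.letter ∧
      ∀ j ∈ D.core.letters, l.length < j := by
  obtain ⟨l, hl⟩ := Word.exists_eq_map_letter (L := D.left) (by
    intro z hz
    rcases D.atom_left z hz with hz' | ⟨u, rfl⟩
    · exact hz'
    · exfalso
      obtain ⟨j, hj⟩ := D.core.letters_nonempty
      have hul := D.letters_left _ hz
      have hul' : (Word.bar u * u : Word).letters ⊆ Set.Icc 1 n := Set.union_subset hul hul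
      obtain ⟨U₁, U₂, hU⟩ := List.append_of_mem hz
      have hjn := (D.letters_core hj).2
      -- The last factor has to stay in place, so the case where it is the barred factor itself is
      -- separate.
      rcases List.eq_nil_or_concat U₂ with rfl | ⟨U₃, y, rfl⟩
      · have := hD.length_left_lt h hU
          (Y := U₁ ++ List.replicate n (Word.bar u * u)) (fun x => by
            rw [hU]
            simp only [wordsEval_append, wordsEval_cons, wordsEval_nil, mul_one, mul_assoc,
              (wordsEval_bar_split h u x n).1]) (by
            intro z hz
            simp only [List.mem_append, List.mem_replicate] at hz
            rcases hz with hz | ⟨-, rfl⟩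
            · exact D.letters_left z (by simp [hU, hz])
            · exact hul') hj
        simp at this
        omega
      · have hU' : D.left = (U₁ ++ Word.bar u :: U₃) ++ [y] := by rw [hU]; simp
        have := hD.length_left_lt h hU'
          (Y := U₁ ++ (List.replicate n (Word.bar u * u) ++ Word.bar u :: U₃)) (fun x => by
            rw [hU]
            simp only [wordsEval_append, wordsEval_cons, wordsEval_nil, mul_one, mul_assoc]
            rw [← mul_assoc (wordsEval x (List.replicate _ _)), (wordsEval_bar_split h u x n).1,
              List.concat_eq_append, wordsEval_append]
            simp) (by
            intro z hz
            simp only [List.mem_append, List.mem_replicate, List.mem_cons] at hz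
            rcases hz with hz | ⟨-, rfl⟩ | rfl | hz
            · exact D.letters_left z (by simp [hU, hz])
            · exact hul'
            · exact hul
            · exact D.letters_left z (by simp [hU, hz])) hj
        simp at this
        omega)
  refine ⟨l, hl, fun j hj => ?_⟩
  rcases List.eq_nil_or_concat D.left with h0 | ⟨U, y, hU⟩
  · rw [hl, List.map_eq_nil_iff] at h0
    rw [h0]
    exact (D.letters_core hj).1
  · rw [List.concat_eq_append] at hU
    have := hD.length_left_lt h hU (Y := U) (fun x => by rw [hU])
      (fun z hz => D.letters_left z (by simp [hU, hz])) hj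
    have h2 := congrArg List.length (hl.symm.trans hU)
    simp at h2
    omega

theorem IsOptimal.right_eq_map_letter (h : BarLaws S) {D : RegularFactorization S n}
    (hD : D.IsOptimal) : ∃ l : List ℕ, D.right = l.map Word.letter ∧
      ∀ j ∈ D.core.letters, l.length ≤ n - j := by
  obtain ⟨l, hl⟩ := Word.exists_eq_map_letter (L := D.right) (by
    intro z hz
    rcases D.atom_right z hz with hz' | ⟨u, rfl⟩
    · exact hz'
    · exfalso
      obtain ⟨j, hj⟩ := D.core.letters_nonempty
      have hul := D.letters_right _ hz
      have hul' : (u * Word.bar u : Word).letters ⊆ Set.Icc 1 n := Set.union_subset hul hul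
      obtain ⟨W₁, W₂, hW⟩ := List.append_of_mem hz
      have hj1 := (D.letters_core hj).1
      cases W₁ with
      | nil =>
        have := hD.length_right_lt h hW
          (Y := List.replicate n (u * Word.bar u) ++ W₂) (fun x => by
            rw [hW]
            simp only [wordsEval_append, wordsEval_cons, wordsEval_nil, one_mul, ← mul_assoc,
              (wordsEval_bar_split h u x n).2]) (by
            intro z hz
            simp only [List.mem_append, List.mem_replicate] at hz
            rcases hz with ⟨-, rfl⟩ | hz
            · exact hul'
            · exact D.letters_right z (by simp [hW, hz])) hj
        simp at this
        omega
      | cons y W₁ =>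
        have := hD.length_right_lt h hW
          (Y := W₁ ++ Word.bar u :: (List.replicate n (u * Word.bar u) ++ W₂)) (fun x => by
            rw [hW]
            simp only [List.cons_append, wordsEval_append, wordsEval_cons]
            rw [← mul_assoc ((((Word.bar u).eval x : S) : WithOne S)),
              (wordsEval_bar_split h u x n).2]) (by
            intro z hz
            simp only [List.mem_append, List.mem_replicate, List.mem_cons] at hz
            rcases hz with hz | rfl | ⟨-, rfl⟩ | hz
            · exact D.letters_right z (by simp [hW, hz])
            · exact hul
            · exact hul'
            · exact D.letters_right z (by simp [hW, hz])) hj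
        simp at this
        omega)
  refine ⟨l, hl, fun j hj => ?_⟩
  cases hW : D.right with
  | nil =>
    rw [hl, List.map_eq_nil_iff] at hW
    rw [hW]; simp
  | cons y W =>
    have := hD.length_right_lt h hW (Y := W) (fun x => by rw [hW])
      (fun z hz => D.letters_right z (by simp [hW, hz])) hj
    have h2 := congrArg List.length (hl.symm.trans hW)
    simp at h2
    omega

end RegularFactorization

end EpigroupVarieties

/-! ### From an optimal factorization to the double bar identity. -/

namespace EpigroupVarieties

theorem exists_iterate_eq_self {α : Type*} {s : α → α} {D : Finset α}
    (hs : Set.MapsTo s D D) (hinj : Set.InjOn s D) : ∃ k, ∀ m ∈ D, s^[k + 1] m = m := by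
  have h1 : Function.Injective (hs.restrict s D D) := (Set.MapsTo.restrict_inj hs).2 hinj
  let f : Equiv.Perm D := Equiv.ofBijective _ (Finite.injective_iff_bijective.1 h1)
  obtain ⟨k, hk⟩ : ∃ k, orderOf f = k + 1 := Nat.exists_eq_succ_of_ne_zero (orderOf_pos f).ne'
  refine ⟨k, fun m hm => ?_⟩
  have h2 : (f ^ (k + 1)) ⟨m, hm⟩ = ⟨m, hm⟩ := by rw [← hk, pow_orderOf_eq_one]; rfl
  have h3 : ∀ (r : ℕ) (a : D), (((f ^ r) a : D) : α) = s^[r] a := by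
    intro r
    induction r with
    | zero => intro a; rfl
    | succ r ih => intro a; rw [pow_succ, Equiv.Perm.mul_apply, ih]; rfl
  rw [← h3 (k + 1) ⟨m, hm⟩, h2]

variable {S : Type u} [UnarySemigroup S] {n : ℕ}

/-- `S` satisfies `x_1 ⋯ x_n = x_1 ⋯ x_{i-1} · w · x_{j+1} ⋯ x_n`, where `w` is the double bar
of `x_i ⋯ x_j`, for some `i ≤ j`. -/
def SatisfiesDoubleBarIdentity (S : Type u) [UnarySemigroup S] (n : ℕ) : Prop :=
  ∃ i j : ℕ, 1 ≤ i ∧ i ≤ j ∧ j ≤ n ∧ ∀ x : ℕ → S, listEval x (List.range' 1 n) =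
    (((Word.doubleBarWord n i j).eval x : S) : WithOne S)

/-- The value of x_m may be replaced by its double bar, so i = j = m works. -/
theorem satisfiesDoubleBarIdentity_of_independent {m : ℕ} (hm : 1 ≤ m) (hmn : m ≤ n)
    (h : ∀ (x : ℕ → S) (a : S), listEval (Function.update x m a) (List.range' 1 n) =
      listEval x (List.range' 1 n)) : SatisfiesDoubleBarIdentity S n := by
  refine ⟨m, m, hm, le_rfl, hmn, fun x => ?_⟩
  rw [Word.coe_eval_doubleBarWord,
    ← h x (UnarySemigroup.bar (UnarySemigroup.bar (x m))), listEval_range'_split _ hm hmn,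
    Function.update_self]
  have h1 : ∀ l : List ℕ, m ∉ l → listEval (Function.update x m
      (UnarySemigroup.bar (UnarySemigroup.bar (x m)))) l = listEval x l := by
    intro l hl
    refine listEval_congr fun i hi => Function.update_of_ne ?_ _ _
    rintro rfl; exact hl hi
  rw [h1 _ (by simp; omega), h1 _ (by simp)]
  have h2 : (Word.block m m).eval x = x m := by simp [Word.block, Word.mulLetterSeq, Word.eval]
  rw [h2]

theorem listEval_range'_split₂ (x : ℕ → S) {i j : ℕ} (hi : 1 ≤ i) (hij : i ≤ j) (hj : j ≤ n) :
    listEval x (List.range' 1 n) = listEval x (List.range' 1 (i - 1)) *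
      listEval x (List.range' i (j + 1 - i)) * listEval x (List.range' (j + 1) (n - j)) := by
  rw [← listEval_append, ← listEval_append]
  congr 1
  have h1 := List.range'_append (s := 1) (m := i - 1) (n := j + 1 - i) (step := 1)
  have h2 := List.range'_append (s := 1) (m := j) (n := n - j) (step := 1)
  rw [show 1 + 1 * (i - 1) = i by omega, show i - 1 + (j + 1 - i) = j by omega] at h1
  rw [show 1 + 1 * j = j + 1 by omega, show j + (n - j) = n by omega] at h2
  rw [h1, h2]

/-- The contexts `x_1 ⋯ x_{i-1} · _ · x_{j+1} ⋯ x_n` do not distinguish two elements. -/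
def contextCon (S : Type u) [UnarySemigroup S] (n i j : ℕ) (hi : 1 ≤ i) (hij : i ≤ j) :
    Con (WithOne S) :=
  have hl : ∀ (c z z' : WithOne S), (∀ x : ℕ → S,
      listEval x (List.range' 1 (i - 1)) * z * listEval x (List.range' (j + 1) (n - j)) =
        listEval x (List.range' 1 (i - 1)) * z' * listEval x (List.range' (j + 1) (n - j))) →
      ∀ x : ℕ → S,
      listEval x (List.range' 1 (i - 1)) * (c * z) * listEval x (List.range' (j + 1) (n - j)) =
        listEval x (List.range' 1 (i - 1)) * (c * z') *
          listEval x (List.range' (j + 1) (n - j)) := by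
    intro c z z' h x
    induction c using WithOne.recOneCoe with
    | one => simpa using h x
    | coe c =>
      -- For i = 1 the left context is empty and c multiplies both sides; otherwise c is absorbed
      -- into the value of the last letter x_{i-1} of the context.
      rcases Nat.exists_eq_add_of_le' hi with ⟨_ | i, rfl⟩
      · have := congrArg (fun y => (c : WithOne S) * y) (h x)
        simpa [mul_assoc] using this
      · have h1 := h (Function.update x (i + 1) (x (i + 1) * c))
        have h2 : ∀ l : List ℕ, i + 1 ∉ l →
            listEval (Function.update x (i + 1) (x (i + 1) * c)) l = listEval x l := by
          intro l hl
          refine listEval_congr fun m hm => Function.update_of_ne ?_ _ _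
          rintro rfl; exact hl hm
        have h3 : List.range' 1 (i + 1 + 1 - 1) = List.range' 1 i ++ [i + 1] := by
          rw [Nat.add_sub_cancel, List.range'_concat]; simp [add_comm]
        rw [h3] at h1 ⊢
        rw [h2 (List.range' (j + 1) (n - j)) (by simp; omega)] at h1
        simp only [listEval_append, listEval_cons, listEval_nil, mul_one, Function.update_self,
          WithOne.coe_mul] at h1 ⊢
        rw [h2 _ (by simp; omega)] at h1
        simpa [mul_assoc] using h1
  have hr : ∀ (c z z' : WithOne S), (∀ x : ℕ → S,
      listEval x (List.range' 1 (i - 1)) * z * listEval x (List.range' (j + 1) (n - j)) =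
        listEval x (List.range' 1 (i - 1)) * z' * listEval x (List.range' (j + 1) (n - j))) →
      ∀ x : ℕ → S,
      listEval x (List.range' 1 (i - 1)) * (z * c) * listEval x (List.range' (j + 1) (n - j)) =
        listEval x (List.range' 1 (i - 1)) * (z' * c) *
          listEval x (List.range' (j + 1) (n - j)) := by
    intro c z z' h x
    induction c using WithOne.recOneCoe with
    | one => simpa using h x
    | coe c =>
      -- Dually, c is absorbed into x_{j+1} unless the right context is empty.
      rcases Nat.eq_zero_or_eq_succ_pred (n - j) with h0 | h0
      · have := congrArg (fun y => y * (c : WithOne S)) (h x)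
        simpa [h0, mul_assoc] using this
      · have h1 := h (Function.update x (j + 1) (c * x (j + 1)))
        have h2 : ∀ l : List ℕ, j + 1 ∉ l →
            listEval (Function.update x (j + 1) (c * x (j + 1))) l = listEval x l := by
          intro l hl
          refine listEval_congr fun m hm => Function.update_of_ne ?_ _ _
          rintro rfl; exact hl hm
        rw [h0, List.range'_succ] at h1 ⊢
        rw [h2 (List.range' 1 (i - 1)) (by simp; omega)] at h1
        simp only [listEval_cons, Function.update_self, WithOne.coe_mul] at h1 ⊢
        rw [h2 _ (by simp)] at h1
        simpa [mul_assoc] using h1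
  { r := fun z z' => ∀ x : ℕ → S,
      listEval x (List.range' 1 (i - 1)) * z * listEval x (List.range' (j + 1) (n - j)) =
        listEval x (List.range' 1 (i - 1)) * z' * listEval x (List.range' (j + 1) (n - j))
    iseqv := ⟨fun _ _ => rfl, fun h x => (h x).symm, fun h h' x => (h x).trans (h' x)⟩
    mul' := fun {a b c d} h h' x => (hr c a b h x).trans (hl b c d h' x) }

/-- Modulo `contextCon`, the value b of x_i⋯x_j equals that of g. So b is completely regular there,
hence congruent to b·b·(bar b), which is its double bar. -/
theorem satisfiesDoubleBarIdentity_of_interval (h : BarLaws S) {i j : ℕ} (hi : 1 ≤ i)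
    (hij : i ≤ j) (hj : j ≤ n) {g : Word} (hg : g.letters ⊆ Set.Icc i j)
    (hreg : ∀ x : ℕ → S, IsCompletelyRegular ((g.eval x : S) : WithOne S))
    (heq : ∀ x : ℕ → S, listEval x (List.range' 1 n) =
      listEval x (List.range' 1 (i - 1)) * (g.eval x : S) *
        listEval x (List.range' (j + 1) (n - j))) : SatisfiesDoubleBarIdentity S n := by
  refine ⟨i, j, hi, hij, hj, fun x => ?_⟩
  set b := (Word.block i j).eval x with hb
  let c := contextCon S n i j hi hij
  have hbg : c (b : S) (g.eval x : S) := by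
    intro y
    -- Letters inside and outside the interval take values independently, since g involves only
    -- inner ones.
    set z : ℕ → S := fun m => if i ≤ m ∧ m ≤ j then x m else y m with hz
    have h1 := heq z
    rw [listEval_range'_split₂ z hi hij hj] at h1
    have e1 : listEval z (List.range' 1 (i - 1)) = listEval y (List.range' 1 (i - 1)) :=
      listEval_congr fun m hm => by
        rw [List.mem_range'_1] at hm; exact if_neg (by omega)
    have e2 : listEval z (List.range' (j + 1) (n - j)) =
        listEval y (List.range' (j + 1) (n - j)) :=
      listEval_congr fun m hm => by
        rw [List.mem_range'_1] at hm; exact if_neg (by omega)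
    have e3 : listEval z (List.range' i (j + 1 - i)) = listEval x (List.range' i (j + 1 - i)) :=
      listEval_congr fun m hm => by
        rw [List.mem_range'_1] at hm; exact if_pos (by omega)
    have e4 : g.eval z = g.eval x := Word.eval_congr fun m hm => if_pos (hg hm)
    rw [e1, e2, e3, e4, ← Word.coe_eval_block x hij, ← hb] at h1
    exact h1
  have hcr : IsCompletelyRegular (c.mk' (b : S)) := by
    have hbg' : c.mk' (b : S) = c.mk' (g.eval x : S) := (Con.eq c).2 hbg
    rw [hbg']
    obtain ⟨g', h1, h2⟩ := hreg x
    exact ⟨c.mk' g', by rw [← map_mul, ← map_mul, h1], by rw [← map_mul, ← map_mul, h2]⟩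
  obtain ⟨k, hk⟩ := h.pow_mul_bar b
  have h1 := hcr.mul_mul_eq_self (c := c.mk' (UnarySemigroup.bar b : S)) (k := k)
    (by rw [← map_pow, ← map_mul, ← map_mul, hk])
  rw [← map_mul, ← map_mul] at h1
  have h2 : c ((b : WithOne S) * b * (UnarySemigroup.bar b : S)) (b : S) := (Con.eq c).1 h1
  have h3 := h2 x
  rw [listEval_range'_split₂ x hi hij hj, ← Word.coe_eval_block x hij, ← hb, ← h3,
    Word.coe_eval_doubleBarWord, ← hb, h.bar_bar]
  simp only [WithOne.coe_mul, mul_assoc]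

/-- If all letters of the core form an interval and the other letters are permuted by the
identity, then an iteration restores their order. -/
theorem satisfiesDoubleBarIdentity_of_permutation (h : BarLaws S) {i j : ℕ} (hi : 1 ≤ i)
    (hij : i ≤ j) (hj : j ≤ n) {g : Word} (hg : g.letters ⊆ Set.Icc i j)
    (hreg : ∀ x : ℕ → S, IsCompletelyRegular ((g.eval x : S) : WithOne S))
    {s : ℕ → ℕ} (hs : Set.MapsTo s ↑(Finset.Icc 1 n \ Finset.Icc i j)
      ↑(Finset.Icc 1 n \ Finset.Icc i j))
    (hinj : Set.InjOn s ↑(Finset.Icc 1 n \ Finset.Icc i j))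
    (heq : ∀ x : ℕ → S, listEval x (List.range' 1 n) =
      listEval (x ∘ s) (List.range' 1 (i - 1)) * (g.eval x : S) *
        listEval (x ∘ s) (List.range' (j + 1) (n - j))) : SatisfiesDoubleBarIdentity S n := by
  have key : ∀ k : ℕ, ∃ g' : Word, g'.letters ⊆ Set.Icc i j ∧
      (∀ x : ℕ → S, IsCompletelyRegular ((g'.eval x : S) : WithOne S)) ∧
      ∀ x : ℕ → S, listEval x (List.range' 1 n) =
        listEval (x ∘ s^[k + 1]) (List.range' 1 (i - 1)) * (g'.eval x : S) *
          listEval (x ∘ s^[k + 1]) (List.range' (j + 1) (n - j)) := by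
    intro k
    induction k with
    | zero => exact ⟨g, hg, hreg, heq⟩
    | succ k ih =>
      obtain ⟨g', hg', hreg', heq'⟩ := ih
      -- The inner block takes the value g'·1⋯1, with 1 the local unit of g', and the outer letters
      -- are permuted k + 1 times; one more use of the identity adds another s.
      set σ : ℕ → Word := fun m => if m = i then g' else
        if i < m ∧ m ≤ j then Word.bar g' * g' else Word.letter (s^[k + 1] m) with hσ
      have hσl : ∀ m ∈ Set.Icc i j, (σ m).letters ⊆ Set.Icc i j := by
        rintro m ⟨h1, h2⟩
        simp only [hσ]
        split_ifs with h3 h4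
        · exact hg'
        · exact Set.union_subset hg' hg'
        · omega
      refine ⟨g.subst σ, ?_, fun x => by rw [Word.eval_subst]; exact hreg _, fun x => ?_⟩
      · rw [Word.letters_subst]
        exact Set.iUnion₂_subset fun m hm => hσl m (hg hm)
      · set y : ℕ → S := fun m => (σ m).eval x with hy
        have hout : ∀ m, m < i ∨ j < m → y m = x (s^[k + 1] m) := by
          intro m hm
          simp only [hy, hσ]
          rw [if_neg (by omega), if_neg (by omega), Word.eval_letter]
        have hinner : listEval y (List.range' i (j + 1 - i)) = (g'.eval x : S) := by
          rw [show j + 1 - i = (j - i) + 1 by omega, List.range'_succ, listEval_cons]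
          have h1 : y i = g'.eval x := by simp [hy, hσ]
          rw [h1, listEval_const (a := UnarySemigroup.bar (g'.eval x) * g'.eval x)]
          · have h2 := h.mul_mul_bar_of_isCompletelyRegular (hreg' x)
            have h3 : ((g'.eval x : S) : WithOne S) *
                ((UnarySemigroup.bar (g'.eval x) * g'.eval x : S) : WithOne S) =
                (g'.eval x : S) := by
              rw [← h.mul_bar, WithOne.coe_mul, ← mul_assoc, h2]
            have h4 : ∀ r : ℕ, ((g'.eval x : S) : WithOne S) *
                ((UnarySemigroup.bar (g'.eval x) * g'.eval x : S) : WithOne S) ^ r =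
                (g'.eval x : S) := by
              intro r
              induction r with
              | zero => simp
              | succ r ihr => rw [pow_succ', ← mul_assoc, h3, ihr]
            exact h4 _
          · intro m hm
            rw [List.mem_range'_1] at hm
            simp only [hy, hσ]
            rw [if_neg (by omega), if_pos (by omega)]
            rfl
        have hO : ∀ l : List ℕ, (∀ m ∈ l, m ∈ Finset.Icc 1 n \ Finset.Icc i j) →
            listEval y l = listEval (x ∘ s^[k + 1]) l ∧
              listEval (y ∘ s) l = listEval (x ∘ s^[k + 1 + 1]) l := by
          intro l hl
          constructor
          · refine listEval_congr fun m hm => hout m ?_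
            have := hl m hm
            simp at this; omega
          · refine listEval_congr fun m hm => ?_
            have h1 : s m ∈ Finset.Icc 1 n \ Finset.Icc i j := hs (hl m hm)
            have h2 : s m < i ∨ j < s m := by simp at h1; omega
            exact hout (s m) h2
        have hO1 := hO (List.range' 1 (i - 1)) fun m hm => by
          rw [List.mem_range'_1] at hm; simp; omega
        have hO2 := hO (List.range' (j + 1) (n - j)) fun m hm => by
          rw [List.mem_range'_1] at hm; simp; omega
        rw [heq', ← hO1.1, ← hO2.1, ← hinner, ← listEval_range'_split₂ y hi hij hj, heq y,
          hO1.2, hO2.2, Word.eval_subst]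
  obtain ⟨k, hk⟩ := exists_iterate_eq_self hs hinj
  obtain ⟨g', hg', hreg', heq'⟩ := key k
  refine satisfiesDoubleBarIdentity_of_interval h hi hij hj hg' hreg' fun x => ?_
  have hO : ∀ l : List ℕ, (∀ m ∈ l, m ∈ Finset.Icc 1 n \ Finset.Icc i j) →
      listEval (x ∘ s^[k + 1]) l = listEval x l := fun l hl =>
    listEval_congr fun m hm => by rw [Function.comp_apply, hk m (hl m hm)]
  rw [heq', hO, hO]
  · intro m hm; rw [List.mem_range'_1] at hm; simp; omega
  · intro m hm; rw [List.mem_range'_1] at hm; simp; omega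

/-- The length bounds leave at most (i - 1) + (n - j) places outside the core, just the number of
letters outside the interval. If no letter is missing, each of these occurs there exactly once. -/
theorem RegularFactorization.IsOptimal.satisfiesDoubleBarIdentity (h : BarLaws S)
    {D : RegularFactorization S n} (hD : D.IsOptimal) : SatisfiesDoubleBarIdentity S n := by
  classical
  obtain ⟨u, hu, hul⟩ := hD.left_eq_map_letter h
  obtain ⟨v, hv, hvl⟩ := hD.right_eq_map_letter h
  have heq : ∀ x : ℕ → S, listEval x (List.range' 1 n) =
      listEval x u * (D.core.eval x : S) * listEval x v := by
    intro x
    rw [D.eval_eq, hu, hv, wordsEval_map_letter, wordsEval_map_letter]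
  by_cases hmiss : ∃ m, 1 ≤ m ∧ m ≤ n ∧ m ∉ u ∧ m ∉ v ∧ m ∉ D.core.letters
  · obtain ⟨m, hm1, hmn, hmu, hmv, hmg⟩ := hmiss
    refine satisfiesDoubleBarIdentity_of_independent hm1 hmn fun x a => ?_
    have h1 : ∀ i, i ≠ m → Function.update x m a i = x i := fun i hi =>
      Function.update_of_ne hi _ _
    rw [heq, heq, listEval_congr fun i hi => h1 i fun h0 => hmu (h0 ▸ hi),
      listEval_congr (l := v) fun i hi => h1 i fun h0 => hmv (h0 ▸ hi),
      Word.eval_congr fun i hi => h1 i fun h0 => hmg (h0 ▸ hi)]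
  push Not at hmiss
  set C := D.letters_finite.toFinset with hC
  have hCmem : ∀ m, m ∈ C ↔ m ∈ D.core.letters := by simp [hC]
  have hCne : C.Nonempty := by simpa [hC] using D.core.letters_nonempty
  set i := C.min' hCne with hi
  set j := C.max' hCne with hj
  have hiC : i ∈ D.core.letters := (hCmem i).1 (C.min'_mem hCne)
  have hjC : j ∈ D.core.letters := (hCmem j).1 (C.max'_mem hCne)
  have hi1 := (D.letters_core hiC).1
  have hjn := (D.letters_core hjC).2
  have hij : i ≤ j := C.min'_le_max' hCne
  have hCsub : C ⊆ Finset.Icc i j := fun m hm =>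
    Finset.mem_Icc.2 ⟨C.min'_le m hm, C.le_max' m hm⟩
  have hui := hul i hiC
  have hvj := hvl j hjC
  have hcover : Finset.Icc 1 n \ C ⊆ (u ++ v).toFinset := by
    intro m hm
    simp only [Finset.mem_sdiff, Finset.mem_Icc] at hm
    rw [List.mem_toFinset, List.mem_append]
    by_contra hcon
    push Not at hcon
    exact hm.2 ((hCmem m).2 (hmiss m hm.1.1 hm.1.2 hcon.1 hcon.2))
  have hcard1 : (Finset.Icc 1 n \ Finset.Icc i j).card = (i - 1) + (n - j) := by
    rw [Finset.card_sdiff_of_subset (Finset.Icc_subset_Icc hi1 hjn), Nat.card_Icc, Nat.card_Icc]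
    omega
  have hsub : Finset.Icc 1 n \ Finset.Icc i j ⊆ (u ++ v).toFinset :=
    (Finset.sdiff_subset_sdiff subset_rfl hCsub).trans hcover
  have hcard2 := Finset.card_le_card hsub
  have hcard3 := List.toFinset_card_le (u ++ v)
  rw [List.length_append] at hcard3
  have hulen : u.length = i - 1 := by omega
  have hvlen : v.length = n - j := by omega
  have hset : Finset.Icc 1 n \ Finset.Icc i j = (u ++ v).toFinset :=
    Finset.eq_of_subset_of_card_le hsub (by omega)
  have hnodup : (u ++ v).Nodup := by
    refine Multiset.coe_nodup.1 (Multiset.toFinset_card_eq_card_iff_nodup.1 ?_)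
    change (u ++ v).toFinset.card = (u ++ v).length
    rw [List.length_append]
    omega
  -- Position m < i is entry m - 1 of u, and position m > j is entry m - j - 1 of v, shifted by the
  -- length i - 1 of u.
  set s : ℕ → ℕ := fun m => (u ++ v).getD (if m < i then m - 1 else m - j - 1 + (i - 1)) 0
    with hs
  have hidx : ∀ m ∈ Finset.Icc 1 n \ Finset.Icc i j,
      (if m < i then m - 1 else m - j - 1 + (i - 1)) < (u ++ v).length := by
    intro m hm
    simp only [Finset.mem_sdiff, Finset.mem_Icc] at hm
    rw [List.length_append]
    split_ifs <;> omega
  refine satisfiesDoubleBarIdentity_of_permutation h hi1 hij hjn (g := D.core) (s := s)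
    (fun m hm => Finset.mem_Icc.1 (hCsub ((hCmem m).2 hm))) D.regular ?_ ?_ ?_
  · intro m hm
    rw [hset]
    simp only [hs, Finset.mem_coe, List.mem_toFinset]
    rw [List.getD_eq_getElem _ _ (hidx m hm)]
    exact List.getElem_mem _
  · intro m hm m' hm' hmm
    simp only [hs] at hmm
    rw [List.getD_eq_getElem _ _ (hidx m hm), List.getD_eq_getElem _ _ (hidx m' hm'),
      hnodup.getElem_inj_iff] at hmm
    simp only [Finset.coe_sdiff, Set.mem_sdiff, Finset.mem_coe, Finset.mem_Icc] at hm hm'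
    split_ifs at hmm <;> omega
  · intro x
    have h1 : (List.range' 1 (i - 1)).map s = u := by
      apply List.ext_getElem
      · simp [hulen]
      · intro k hk hk'
        simp only [List.getElem_map, List.getElem_range', hs]
        rw [if_pos (by omega), List.getD_eq_getElem _ _ (by rw [List.length_append]; omega),
          List.getElem_append_left (by omega)]
        congr 1; omega
    have h2 : (List.range' (j + 1) (n - j)).map s = v := by
      apply List.ext_getElem
      · simp [hvlen]
      · intro k hk hk'
        simp only [List.getElem_map, List.getElem_range', hs]
        rw [if_neg (by omega), List.getD_eq_getElem _ _ (by rw [List.length_append]; omega),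
          List.getElem_append_right (by omega)]
        congr 1; omega
    have h3 : ∀ l : List ℕ, listEval (x ∘ s) l = listEval x (l.map s) := by
      intro l; simp [listEval, Function.comp_def]
    rw [heq, h3, h3, h1, h2]

end EpigroupVarieties

namespace EpigroupVarieties

/-! ### The implication 3 → 4. -/

section LongIdentityToDoubleBar

/-- The index relation at a generic element is an equality of word values, hence an identity of V.
-/
theorem exists_uniform_index {V : Set UnarySemigrp.{u}} {S : UnarySemigrp.{u}}
    (hS : S ∈ V) (h : BarLaws S.carrier) {ξ : ℕ → S.carrier}
    (hξ : ∀ u v : Word, u.eval ξ = v.eval ξ → ClassSatisfies V u v) :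
    ∃ N : ℕ, ∀ a : S.carrier, (a : WithOne S.carrier) ^ (N + 1) * a *
      (UnarySemigroup.bar a : S.carrier) = (a : WithOne S.carrier) ^ (N + 1) := by
  obtain ⟨N, hN⟩ := h.pow_mul_bar (ξ 0)
  have hpow : ∀ (x : ℕ → S.carrier) (k : ℕ),
      (((Word.mulLetterSeq (Word.letter 0) (List.replicate k 0)).eval x : S.carrier) :
        WithOne S.carrier) = (x 0 : WithOne S.carrier) ^ (k + 1) := by
    intro x k
    rw [Word.coe_eval_mulLetterSeq, Word.eval_letter, pow_succ',
      listEval_const (a := x 0) fun i hi => by rw [List.eq_of_mem_replicate hi],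
      List.length_replicate]
  refine ⟨N, fun a => ?_⟩
  have h1 := hξ (Word.mulLetterSeq (Word.letter 0) (List.replicate (N + 1) 0) *
    Word.bar (Word.letter 0)) (Word.mulLetterSeq (Word.letter 0) (List.replicate N 0)) (by
      apply WithOne.coe_injective
      rw [Word.eval_mul, WithOne.coe_mul, hpow, hpow, pow_succ]
      exact hN) S hS fun _ => a
  have h2 := congrArg (WithOne.coe : S.carrier → WithOne S.carrier) h1
  simp only [Word.eval_mul, WithOne.coe_mul, hpow] at h2
  rw [pow_succ] at h2
  exact h2

theorem exists_doubleBar_of_long_identity {n : ℕ} (hn : 1 ≤ n) {V : Set UnarySemigrp.{u}}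
    (hV : IsEpigroupVariety V) {w : Word} (hw : (n : ℕ∞) < w.length)
    (hVw : ClassSatisfies V (Word.block 1 n) w) :
    ∃ i j : ℕ, 1 ≤ i ∧ i ≤ j ∧ j ≤ n ∧
      ClassSatisfies V (Word.block 1 n) (Word.doubleBarWord n i j) := by
  obtain ⟨S, hS, ξ, hξ⟩ := hV.1.exists_generic
  have h := barLaws_of_isPseudoinverse (hV.2 S hS).2
  obtain ⟨N, hN⟩ := exists_uniform_index hS h hξ
  have hblock : ∀ x : ℕ → S.carrier, (((Word.block 1 n).eval x : S.carrier) :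
      WithOne S.carrier) = listEval x (List.range' 1 n) := by
    intro x
    rw [Word.coe_eval_block x hn, Nat.add_sub_cancel]
  obtain ⟨D, hD⟩ := RegularFactorization.exists_isOptimal
    (RegularFactorization.nonempty_of_identity h hn hN hw fun x => by
      rw [← hblock]; exact congrArg _ (hVw S hS x))
  obtain ⟨i, j, hi, hij, hj, hdb⟩ := hD.satisfiesDoubleBarIdentity h
  refine ⟨i, j, hi, hij, hj, hξ _ _ ?_⟩
  apply WithOne.coe_injective
  rw [hblock, hdb]

end LongIdentityToDoubleBar

/-! ### The implication 4 → 1. -/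

section Nilsemigroups

theorem coe_seqProd {S : Type u} [UnarySemigroup S] (x : ℕ → S) (k : ℕ) :
    ((seqProd x k : S) : WithOne S) =
      listEval (fun i => x (i - 1)) (List.range' 1 (k + 1)) := by
  induction k with
  | zero => simp [seqProd]
  | succ k ih =>
    rw [List.range'_concat, listEval_append, ← ih]
    simp [seqProd]

theorem IsZeroElement.mul_coe {S : Type u} [Semigroup S] {z : S} (hz : IsZeroElement z)
    (a : WithOne S) : (z : WithOne S) * a = z ∧ a * z = z := by
  induction a using WithOne.recOneCoe with
  | one => simp
  | coe a => rw [← WithOne.coe_mul, ← WithOne.coe_mul, (hz a).1, (hz a).2]; simp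

theorem IsZeroElement.eq {S : Type u} [Semigroup S] {y z : S} (hy : IsZeroElement y)
    (hz : IsZeroElement z) : y = z := by
  rw [← (hy z).1, (hz y).2]

theorem BarLaws.bar_eq_of_mul_bar_eq {S : Type u} [UnarySemigroup S] (h : BarLaws S) {z a : S}
    (hz : IsZeroElement z) (ha : a * UnarySemigroup.bar a = z) : UnarySemigroup.bar a = z := by
  rw [← h.bar_mul_bar, mul_assoc, ha, (hz _).2]

theorem BarLaws.mul_bar_idempotent {S : Type u} [UnarySemigroup S] (h : BarLaws S) (a : S) :
    a * UnarySemigroup.bar a * (a * UnarySemigroup.bar a) = a * UnarySemigroup.bar a := by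
  rw [mul_assoc, ← mul_assoc (UnarySemigroup.bar a), h.bar_mul_bar]

/-- The product of a and its bar is idempotent, and the only idempotent of a nilsemigroup is zero.
-/
theorem BarLaws.bar_eq_zero {S : Type u} [UnarySemigroup S] (h : BarLaws S) {z : S}
    (hz : IsZeroElement z) (hnil : ∀ a : S, ∃ k : ℕ, powSucc a k = z) (a : S) :
    UnarySemigroup.bar a = z := by
  refine h.bar_eq_of_mul_bar_eq hz ?_
  obtain ⟨k, hk⟩ := hnil (a * UnarySemigroup.bar a)
  rw [← hk]
  have : ∀ k, powSucc (a * UnarySemigroup.bar a) k = a * UnarySemigroup.bar a := by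
    intro k
    induction k with
    | zero => rfl
    | succ k ih =>
      change powSucc (a * UnarySemigroup.bar a) k * (a * UnarySemigroup.bar a) = _
      rw [ih, h.mul_bar_idempotent]
  exact (this k).symm

theorem hasDegreeAtMost_of_doubleBar {n : ℕ} (hn : 1 ≤ n) {V : Set UnarySemigrp.{u}}
    (hV : IsEpigroupVariety V) {i j : ℕ}
    (hVw : ClassSatisfies V (Word.block 1 n) (Word.doubleBarWord n i j)) :
    HasDegreeAtMost V n := by
  rintro S hS ⟨z, hz, hnil⟩
  have h := barLaws_of_isPseudoinverse (hV.2 S hS).2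
  have hmem : n ∈ {m : ℕ | ∃ k : ℕ, m = k + 1 ∧
      ∃ z : S.carrier, IsZeroElement z ∧ ∀ x : ℕ → S.carrier, seqProd x k = z} := by
    obtain ⟨k, rfl⟩ := Nat.exists_eq_add_of_le' hn
    refine ⟨k, rfl, z, hz, fun x => ?_⟩
    apply WithOne.coe_injective
    have h1 := congrArg (WithOne.coe : S.carrier → WithOne S.carrier)
      (hVw S hS fun i => x (i - 1))
    rw [Word.coe_eval_block _ hn, Word.coe_eval_doubleBarWord, h.bar_eq_zero hz hnil,
      (hz.mul_coe _).1, (hz.mul_coe _).2] at h1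
    rw [coe_seqProd]
    exact h1
  exact ⟨_, Nat.sInf_le hmem, Nat.sInf_mem ⟨n, hmem⟩, fun m hm => Nat.sInf_le hm⟩

end Nilsemigroups

/-! ### The implication 2 → 3. -/

section FailureInNilVariety

namespace Word

theorem length_eq_top_of_bar_mem_atoms {w u : Word} (h : bar u ∈ w.atoms) : w.length = ⊤ := by
  induction w with
  | letter i => simp [atoms] at h
  | mul u v hu hv =>
    simp only [atoms, List.mem_append] at h
    rcases h with h | h
    · simp [length, hu h]
    · simp [length, hv h]
  | bar u hu => rfl

theorem exists_atoms_eq_map_letter {w : Word} (h : ∀ u, bar u ∉ w.atoms) :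
    ∃ l : List ℕ, w.atoms = l.map letter := by
  refine exists_eq_map_letter fun y hy => ?_
  rcases isAtom_of_mem_atoms hy with hy' | ⟨u, rfl⟩
  · exact hy'
  · exact absurd hy (h u)

theorem length_subst_eq_top {σ : ℕ → Word} {i : ℕ} (hσ : (σ i).length = ⊤) {w : Word}
    (hi : i ∈ w.letters) : (w.subst σ).length = ⊤ := by
  induction w with
  | letter m => cases hi; exact hσ
  | mul u v hu hv =>
    rcases hi with hi | hi
    · simp [subst, length, hu hi]
    · simp [subst, length, hv hi]
  | bar u hu => rfl

theorem length_subst_of_letters {σ : ℕ → ℕ} (w : Word) :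
    (w.subst fun i => letter (σ i)).length = w.length := by
  induction w with
  | letter i => rfl
  | mul u v hu hv => simp [subst, length, hu, hv]
  | bar u hu => rfl

theorem length_mulLetterSeq (w : Word) (l : List ℕ) :
    (mulLetterSeq w l).length = w.length + l.length := by
  induction l generalizing w with
  | nil => simp [mulLetterSeq]
  | cons a l ih =>
    have h1 : mulLetterSeq w (a :: l) = mulLetterSeq (w * letter a) l := rfl
    have h2 : (w * letter a).length = w.length + 1 := rfl
    rw [h1, ih, h2, List.length_cons]
    push_cast
    rw [add_assoc, add_comm 1]

theorem letters_mulLetterSeq (w : Word) (l : List ℕ) :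
    (mulLetterSeq w l).letters = w.letters ∪ {i | i ∈ l} := by
  induction l generalizing w with
  | nil => simp [mulLetterSeq]
  | cons a l ih =>
    have h1 : mulLetterSeq w (a :: l) = mulLetterSeq (w * letter a) l := rfl
    have h2 : (w * letter a).letters = w.letters ∪ {a} := rfl
    rw [h1, ih, h2]
    ext i
    simp [or_assoc, or_left_comm]

theorem coe_eval_of_atoms_eq {S : Type u} [UnarySemigroup S] (x : ℕ → S) {w : Word} {l : List ℕ}
    (h : w.atoms = l.map letter) : ((w.eval x : S) : WithOne S) = listEval x l := by
  rw [← wordsEval_atoms, h, wordsEval_map_letter]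

end Word

/-- An identity between a linear word and a longer word can be turned into one whose left-hand
side is `x_1 ⋯ x_n`. -/
theorem exists_long_identity_of_linear {V : Set UnarySemigrp.{u}} {n : ℕ} (hn : 1 ≤ n)
    {u v : Word} {l : List ℕ} (huv : ClassSatisfies V u v) (hu : u.atoms = l.map Word.letter)
    (hl : l.Nodup) (hln : l.length ≤ n) (hv : u.length < v.length) :
    ∃ w : Word, (n : ℕ∞) < w.length ∧ ClassSatisfies V (Word.block 1 n) w := by
  -- The letters of l are renamed x_1, x_2, … in order of appearance; the remaining letters up to
  -- x_n are then appended to both sides.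
  set σ : ℕ → ℕ := fun i => l.idxOf i + 1 with hσ
  have hσl : l.map σ = List.range' 1 l.length := by
    apply List.ext_getElem
    · simp
    · intro k h1 h2
      simp only [List.length_map] at h1
      simp [hσ, hl.idxOf_getElem k h1, add_comm]
  refine ⟨Word.mulLetterSeq (v.subst fun i => Word.letter (σ i))
    (List.range' (l.length + 1) (n - l.length)), ?_, fun S hS x => ?_⟩
  · rw [Word.length_mulLetterSeq, Word.length_subst_of_letters, List.length_range']
    rw [Word.length_of_atoms_eq hu] at hv
    calc (n : ℕ∞) = (l.length : ℕ∞) + ((n - l.length : ℕ) : ℕ∞) := by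
          rw [← Nat.cast_add]; congr 1; omega
      _ < _ := (ENat.add_lt_add_iff_right (ENat.natCast_ne_top _)).2 hv
  · apply WithOne.coe_injective
    have h1 := huv S hS fun i => x (σ i)
    change u.eval _ = v.eval _ at h1
    have h2 : ((u.eval (fun i => x (σ i)) : S.carrier) : WithOne S.carrier) =
        listEval x (List.range' 1 l.length) := by
      rw [Word.coe_eval_of_atoms_eq _ hu, ← hσl]
      simp [listEval, Function.comp_def]
    rw [Word.coe_eval_block x hn, Word.coe_eval_mulLetterSeq, Word.eval_subst]
    change _ = ((v.eval (fun i => x (σ i)) : S.carrier) : WithOne S.carrier) * _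
    rw [← h1, h2, ← listEval_append]
    have h3 := List.range'_append (s := 1) (m := l.length) (n := n - l.length) (step := 1)
    rw [show 1 + 1 * l.length = l.length + 1 by omega,
      show l.length + (n - l.length) = n by omega] at h3
    rw [h3, Nat.add_sub_cancel]

theorem exists_long_identity_of_eval_ne {V : Set UnarySemigrp.{u}} {n : ℕ} (hn : 1 ≤ n)
    {S : Type u} [UnarySemigroup S] (hcomm : ∀ a b : S, a * b = b * a) {x : ℕ → S}
    {u v : Word} {l : List ℕ} (huv : ClassSatisfies V u v) (hu : u.atoms = l.map Word.letter)
    (hl : l.Nodup) (hln : l.length ≤ n) (hne : u.eval x ≠ v.eval x) :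
    ∃ w : Word, (n : ℕ∞) < w.length ∧ ClassSatisfies V (Word.block 1 n) w := by
  rcases lt_or_ge u.length v.length with hlt | hge
  · exact exists_long_identity_of_linear hn huv hu hl hln hlt
  obtain ⟨l', hl'⟩ : ∃ l' : List ℕ, v.atoms = l'.map Word.letter := by
    refine Word.exists_atoms_eq_map_letter fun y hy => ?_
    rw [Word.length_eq_top_of_bar_mem_atoms hy, Word.length_of_atoms_eq hu] at hge
    exact absurd hge (by simp)
  rw [Word.length_of_atoms_eq hu, Word.length_of_atoms_eq hl', Nat.cast_le] at hge
  -- If v contained every letter of u, then, being no longer, it would be a permutation of u, with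
  -- the same value by commutativity.
  by_cases hsub : l ⊆ l'
  · exfalso
    apply hne
    have hperm := (hl.subperm hsub).perm_of_length_le hge
    apply WithOne.coe_injective
    rw [Word.coe_eval_of_atoms_eq _ hu, Word.coe_eval_of_atoms_eq _ hl']
    refine (hperm.map _).prod_eq' ?_
    refine List.pairwise_of_forall fun a b => ?_
    induction a using WithOne.recOneCoe with
    | one => exact Commute.one_left _
    | coe a =>
      induction b using WithOne.recOneCoe with
      | one => exact Commute.one_right _
      | coe b =>
        change (a : WithOne S) * b = b * a
        rw [← WithOne.coe_mul, hcomm, WithOne.coe_mul]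
  · obtain ⟨i, hi, hi'⟩ : ∃ i ∈ l, i ∉ l' := by
      by_contra hcon
      push Not at hcon
      exact hsub hcon
    -- As x_i is absent from v, barring it in u gives a word still equal to v modulo V, but of
    -- infinite length.
    set σ : ℕ → Word := Function.update Word.letter i (Word.bar (Word.letter i)) with hσ
    have hilet : i ∈ u.letters := by
      refine Word.letters_subset_of_mem_atoms (y := Word.letter i) ?_ rfl
      rw [hu]; exact List.mem_map_of_mem hi
    have htop : (u.subst σ).length = ⊤ :=
      Word.length_subst_eq_top (i := i) (by rw [hσ, Function.update_self]; rfl) hilet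
    refine exists_long_identity_of_linear (v := u.subst σ) hn (fun T hT y => ?_) hu hl hln ?_
    · change u.eval y = (u.subst σ).eval y
      rw [Word.eval_subst]
      have h1 : u.eval y = v.eval y := huv T hT y
      have h2 : u.eval _ = v.eval _ := huv T hT fun m => (σ m).eval y
      rw [h1, h2]
      apply WithOne.coe_injective
      rw [Word.coe_eval_of_atoms_eq _ hl', Word.coe_eval_of_atoms_eq _ hl']
      refine listEval_congr fun m hm => ?_
      rw [hσ, Function.update_of_ne (by rintro rfl; exact hi' hm)]
      rfl
    · rw [htop, Word.length_of_atoms_eq hu]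
      exact ENat.natCast_lt_top _

variable {n : ℕ} {S : UnarySemigrp.{u}}

theorem mul_comm_of_mem_nilVarietyF (hS : S ∈ nilVarietyF n) (a b : S.carrier) :
    a * b = b * a := by
  have h := hS.2 _ (Or.inr rfl) fun i => if i = 1 then a else b
  exact h

theorem isZeroElement_of_satisfies_eqZero {w : Word} {E : Set Identity}
    (hS : ∀ p ∈ E, S.Satisfies p) (hE : eqZero w ⊆ E) {m : ℕ} (hm : m ∉ w.letters)
    (x : ℕ → S.carrier) : IsZeroElement (w.eval x) := by
  intro y
  have h1 : w.eval (Function.update x m y) = w.eval x := Word.eval_congr fun i hi =>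
    Function.update_of_ne (by rintro rfl; exact hm hi) _ _
  have h2 : (w * Word.letter m).eval _ = w.eval _ :=
    hS _ (hE ⟨m, hm, Or.inl rfl⟩) (Function.update x m y)
  have h3 : (Word.letter m * w).eval _ = w.eval _ :=
    hS _ (hE ⟨m, hm, Or.inr rfl⟩) (Function.update x m y)
  rw [Word.eval_mul, Word.eval_letter, Function.update_self, h1] at h2 h3
  exact ⟨h2, h3⟩

theorem isZeroElement_mul_self_of_mem_nilVarietyF (hS : S ∈ nilVarietyF n) (a : S.carrier) :
    IsZeroElement (a * a) :=
  isZeroElement_of_satisfies_eqZero (w := Word.letter 1 * Word.letter 1) hS.2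
    (fun _ hp => Or.inl (Or.inl hp)) (m := 2) (by rintro (h | h) <;> cases h) fun _ => a

theorem isZeroElement_block_of_mem_nilVarietyF (hn : 1 ≤ n) (hS : S ∈ nilVarietyF n)
    (x : ℕ → S.carrier) : IsZeroElement ((Word.block 1 n).eval x) := by
  refine isZeroElement_of_satisfies_eqZero hS.2 (fun _ hp => Or.inl (Or.inr hp)) (m := n + 1) ?_ x
  rw [Word.block, Word.letters_mulLetterSeq]
  rintro (h | h)
  · have : n + 1 = 1 := h
    omega
  · have h' : n + 1 ∈ List.range' (1 + 1) (n - 1) := h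
    rw [List.mem_range'_1] at h'
    omega

/-- Everything else vanishes: bars because idempotents are squares and hence zero, repeated letters
because commutativity gathers them into a square, and longer words because they begin with n + 1
letters. -/
theorem exists_linear_of_eval_ne_zero (hS : S ∈ nilVarietyF (n + 1)) {z : S.carrier}
    (hz : IsZeroElement z) {x : ℕ → S.carrier} {w : Word} (hw : w.eval x ≠ z) :
    ∃ l : List ℕ, w.atoms = l.map Word.letter ∧ l.Nodup ∧ l.length ≤ n := by
  have h := barLaws_of_isPseudoinverse hS.1.2
  have hbar : ∀ a : S.carrier, UnarySemigroup.bar a = z := by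
    intro a
    refine h.bar_eq_of_mul_bar_eq hz ?_
    rw [← h.mul_bar_idempotent]
    exact (isZeroElement_mul_self_of_mem_nilVarietyF hS _).eq hz
  have hsq : ∀ a : S.carrier, a * a = z := fun a =>
    (isZeroElement_mul_self_of_mem_nilVarietyF hS a).eq hz
  have hcomm : ∀ (a : S.carrier) (b : WithOne S.carrier), a * b = b * a := by
    intro a b
    induction b using WithOne.recOneCoe with
    | one => simp
    | coe b => rw [← WithOne.coe_mul, mul_comm_of_mem_nilVarietyF hS, WithOne.coe_mul]
  obtain ⟨l, hl⟩ : ∃ l : List ℕ, w.atoms = l.map Word.letter := by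
    refine Word.exists_atoms_eq_map_letter fun y hy => hw ?_
    obtain ⟨A, B, hAB⟩ := List.append_of_mem hy
    apply WithOne.coe_injective
    rw [← Word.wordsEval_atoms, hAB, wordsEval_append, wordsEval_cons, Word.eval_bar, hbar,
      (hz.mul_coe _).1, (hz.mul_coe _).2]
  refine ⟨l, hl, ?_, ?_⟩
  · by_contra hcon
    obtain ⟨q, hq⟩ := List.exists_duplicate_iff_not_nodup.2 hcon
    rw [List.duplicate_iff_sublist, List.cons_sublist_iff] at hq
    obtain ⟨r₁, r₂, rfl, h2, h3⟩ := hq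
    rw [List.singleton_sublist] at h3
    obtain ⟨a, b, rfl⟩ := List.append_of_mem h2
    obtain ⟨c, d, rfl⟩ := List.append_of_mem h3
    apply hw
    apply WithOne.coe_injective
    rw [Word.coe_eval_of_atoms_eq _ hl]
    simp only [listEval_append, listEval_cons]
    calc _ = listEval x a * ((x q : WithOne S.carrier) * (listEval x b * listEval x c) * (x q) *
          listEval x d) := by simp only [mul_assoc]
      _ = listEval x a * (((x q * x q : S.carrier) : WithOne S.carrier) *
          (listEval x b * listEval x c * listEval x d)) := by
        rw [WithOne.coe_mul, mul_assoc (x q : WithOne S.carrier) _ (x q : WithOne S.carrier),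
          ← hcomm]
        simp only [mul_assoc]
      _ = z := by rw [hsq, (hz.mul_coe _).1, (hz.mul_coe _).2]
  · by_contra hcon
    obtain ⟨l₁, l₂, rfl, hl₁⟩ := exists_append_of_le_length (l := l) (k := n + 1) (by omega)
    apply hw
    apply WithOne.coe_injective
    have h1 := isZeroElement_block_of_mem_nilVarietyF (Nat.le_add_left 1 n) hS
      fun i => x (l₁.getD (i - 1) 0)
    have h2 : listEval x l₁ = (z : WithOne S.carrier) := by
      rw [← h1.eq hz, Word.coe_eval_block _ (Nat.le_add_left 1 n), Nat.add_sub_cancel]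
      unfold listEval
      congr 1
      apply List.ext_getElem
      · simp [hl₁]
      · intro k hk hk'
        simp only [List.length_map] at hk
        simp [hk]
    rw [Word.coe_eval_of_atoms_eq _ hl, listEval_append, h2, (hz.mul_coe _).1]

theorem exists_long_identity_of_not_subset (hn : 1 ≤ n) {V : Set UnarySemigrp.{u}}
    (hV : IsVariety V) (hF : ¬ nilVarietyF (n + 1) ⊆ V) :
    ∃ w : Word, (n : ℕ∞) < w.length ∧ ClassSatisfies V (Word.block 1 n) w := by
  obtain ⟨S, hS, hSV⟩ := Set.not_subset.1 hF
  obtain ⟨E, hE⟩ := hV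
  have hfail : ∃ p ∈ E, ∃ x : ℕ → S.carrier, p.1.eval x ≠ p.2.eval x := by
    by_contra hcon
    push Not at hcon
    apply hSV
    rw [hE]
    exact hcon
  obtain ⟨⟨u, v⟩, hp, x, hne⟩ := hfail
  have huv : ClassSatisfies V u v := by
    intro T hT
    rw [hE] at hT
    exact hT _ hp
  have hcomm := mul_comm_of_mem_nilVarietyF hS
  have hz := isZeroElement_mul_self_of_mem_nilVarietyF hS (x 0)
  by_cases hu : u.eval x = x 0 * x 0
  · have hv : v.eval x ≠ x 0 * x 0 := fun h => hne (hu.trans h.symm)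
    obtain ⟨l, hl, hnd, hln⟩ := exists_linear_of_eval_ne_zero hS hz hv
    exact exists_long_identity_of_eval_ne hn hcomm (fun T hT y => (huv T hT y).symm) hl hnd hln
      (Ne.symm hne)
  · obtain ⟨l, hl, hnd, hln⟩ := exists_linear_of_eval_ne_zero hS hz hu
    exact exists_long_identity_of_eval_ne hn hcomm huv hl hnd hln hne

end FailureInNilVariety

/-! ### The implication 1 → 2. -/

section NilpotentModel

/-- The sets of elements of `Fin n`, the product of disjoint nonempty sets being their union
and all other products being empty. -/
def DisjointUnions (n : ℕ) : Type u := ULift.{u} (Finset (Fin n))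

namespace DisjointUnions

/-- The product. -/
def prod {n : ℕ} (A B : Finset (Fin n)) : Finset (Fin n) :=
  if A.Nonempty ∧ B.Nonempty ∧ Disjoint A B then A ∪ B else ∅

variable {n : ℕ}

theorem prod_empty (A : Finset (Fin n)) : prod A ∅ = ∅ := by simp [prod]

theorem empty_prod (A : Finset (Fin n)) : prod ∅ A = ∅ := by simp [prod]

theorem prod_comm (A B : Finset (Fin n)) : prod A B = prod B A := by
  unfold prod
  rw [Finset.union_comm]
  exact if_congr ⟨fun h => ⟨h.2.1, h.1, h.2.2.symm⟩, fun h => ⟨h.2.1, h.1, h.2.2.symm⟩⟩ rfl rfl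

theorem prod_self (A : Finset (Fin n)) : prod A A = ∅ := by
  unfold prod
  rw [if_neg]
  rintro ⟨h1, -, h2⟩
  rw [disjoint_self] at h2
  exact h1.ne_empty h2

theorem prod_assoc (A B C : Finset (Fin n)) : prod (prod A B) C = prod A (prod B C) := by
  rcases A.eq_empty_or_nonempty with rfl | hA
  · simp only [empty_prod]
  rcases B.eq_empty_or_nonempty with rfl | hB
  · simp only [empty_prod, prod_empty]
  rcases C.eq_empty_or_nonempty with rfl | hC
  · simp only [prod_empty]
  by_cases hAB : Disjoint A B <;> by_cases hAC : Disjoint A C <;> by_cases hBC : Disjoint B C <;>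
    simp [prod, hA, hB, hC, hAB, hAC, hBC, Finset.disjoint_union_left,
      Finset.disjoint_union_right, Finset.union_assoc]

instance : UnarySemigroup (DisjointUnions.{u} n) where
  mul A B := ⟨prod A.down B.down⟩
  mul_assoc A B C := congrArg ULift.up (prod_assoc A.down B.down C.down)
  bar _ := ⟨∅⟩

/-- The zero element. -/
def zero (n : ℕ) : DisjointUnions.{u} n := ⟨∅⟩

theorem mul_self (A : DisjointUnions.{u} n) : A * A = zero n := congrArg ULift.up (prod_self A.down)

theorem isZeroElement_zero : IsZeroElement (zero.{u} n) := fun A =>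
  ⟨congrArg ULift.up (empty_prod A.down), congrArg ULift.up (prod_empty A.down)⟩

theorem isSubgroupOf_zero : IsSubgroupOf {zero.{u} n} (zero n) where
  unit_mem := rfl
  mul_mem := by rintro _ rfl _ rfl; exact mul_self _
  unit_mul := by rintro _ rfl; exact mul_self _
  mul_unit := by rintro _ rfl; exact mul_self _
  exists_inv := by rintro _ rfl; exact ⟨_, rfl, mul_self _, mul_self _⟩

theorem isMaximalSubgroupOf_zero : IsMaximalSubgroupOf {zero.{u} n} (zero n) := by
  refine ⟨isSubgroupOf_zero, fun H f hH hsub A hA => ?_⟩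
  have h0 : zero n ∈ H := hsub rfl
  obtain ⟨y, -, h1, -⟩ := hH.exists_inv _ h0
  rw [(isZeroElement_zero y).1] at h1
  rw [Set.mem_singleton_iff, ← hH.unit_mul A hA, ← h1, (isZeroElement_zero A).1]

theorem powSucc_one (A : DisjointUnions.{u} n) : powSucc A 1 = zero n := mul_self A

theorem isEpigroup : (⟨DisjointUnions.{u} n⟩ : UnarySemigrp.{u}).IsEpigroup := by
  refine ⟨fun A => ⟨1, _, _, isSubgroupOf_zero, powSucc_one A⟩, fun A => ?_⟩
  exact ⟨_, _, isMaximalSubgroupOf_zero, ⟨1, powSucc_one A⟩, (isZeroElement_zero A).2, rfl,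
    (isZeroElement_zero _).2, (isZeroElement_zero _).1⟩

/-- Each factor of a nonzero product adds at least one new point, so products of n + 1 sets vanish.
-/
theorem eval_mulLetterSeq (x : ℕ → DisjointUnions.{u} n) (w : Word) (l : List ℕ) :
    (Word.mulLetterSeq w l).eval x = zero n ∨
      (w.eval x).down.card + l.length ≤ ((Word.mulLetterSeq w l).eval x).down.card := by
  induction l generalizing w with
  | nil => right; simp [Word.mulLetterSeq]
  | cons a l ih =>
    have h1 : Word.mulLetterSeq w (a :: l) = Word.mulLetterSeq (w * Word.letter a) l := rfl
    rw [h1]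
    rcases ih (w * Word.letter a) with h2 | h2
    · exact Or.inl h2
    by_cases hdis : (w.eval x).down.Nonempty ∧ (x a).down.Nonempty ∧
        Disjoint (w.eval x).down (x a).down
    · right
      have h3 : ((w * Word.letter a).eval x).down = (w.eval x).down ∪ (x a).down := if_pos hdis
      rw [h3, Finset.card_union_of_disjoint hdis.2.2] at h2
      have := hdis.2.1.card_pos
      rw [List.length_cons]
      omega
    · left
      have h3 : (w * Word.letter a).eval x = zero n := congrArg ULift.up (if_neg hdis)
      apply WithOne.coe_injective
      rw [Word.coe_eval_mulLetterSeq, h3, (isZeroElement_zero.mul_coe _).1]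

theorem eval_block (x : ℕ → DisjointUnions.{u} n) :
    (Word.block 1 (n + 1)).eval x = zero n := by
  rcases eval_mulLetterSeq x (Word.letter 1) (List.range' (1 + 1) (n + 1 - 1)) with h | h
  · exact h
  · rcases (x 1).down.eq_empty_or_nonempty with h0 | h0
    · apply WithOne.coe_injective
      have h1 : (Word.letter 1).eval x = zero n := congrArg ULift.up h0
      rw [Word.block, Word.coe_eval_mulLetterSeq, h1, (isZeroElement_zero.mul_coe _).1]
    · exfalso
      have h1 := Finset.card_le_univ
        ((Word.mulLetterSeq (Word.letter 1) (List.range' (1 + 1) (n + 1 - 1))).eval x).down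
      have h2 := h0.card_pos
      rw [Word.eval_letter, List.length_range'] at h
      rw [Fintype.card_fin] at h1
      omega

theorem satisfies_eqZero {w : Word} (hw : ∀ x : ℕ → DisjointUnions.{u} n, w.eval x = zero n)
    {p : Identity} (hp : p ∈ eqZero w) :
    (⟨DisjointUnions.{u} n⟩ : UnarySemigrp.{u}).Satisfies p := by
  intro x
  obtain ⟨m, -, rfl | rfl⟩ := hp
  · change (w * Word.letter m).eval x = w.eval x
    rw [Word.eval_mul, hw, (isZeroElement_zero _).1]
  · change (Word.letter m * w).eval x = w.eval x
    rw [Word.eval_mul, hw, (isZeroElement_zero _).2]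

theorem mem_nilVarietyF : (⟨DisjointUnions.{u} n⟩ : UnarySemigrp.{u}) ∈ nilVarietyF (n + 1) := by
  refine ⟨isEpigroup, ?_⟩
  rintro p ((hp | hp) | rfl)
  · exact satisfies_eqZero (w := Word.letter 1 * Word.letter 1) (fun x => mul_self (x 1)) hp
  · exact satisfies_eqZero eval_block hp
  · exact fun x => congrArg ULift.up (prod_comm _ _)

theorem isNilsemigroup : IsNilsemigroup (DisjointUnions.{u} n) :=
  ⟨zero n, isZeroElement_zero, fun A => ⟨1, powSucc_one A⟩⟩

/-- The set of elements whose value has a given property. -/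
def ofPred (n : ℕ) (p : ℕ → Prop) [DecidablePred p] : DisjointUnions.{u} n :=
  ⟨Finset.univ.filter fun m : Fin n => p m⟩

theorem seqProd_ofPred_eq {k : ℕ} (hk : k < n) :
    seqProd (fun i => ofPred.{u} n (· = i)) k = ofPred n (· ≤ k) := by
  induction k with
  | zero => exact congrArg ULift.up (by simp)
  | succ k ih =>
    change seqProd (fun i => ofPred.{u} n (· = i)) k * ofPred n (· = k + 1) = _
    rw [ih (by omega)]
    refine congrArg ULift.up ((if_pos ⟨⟨⟨0, by omega⟩, by simp [ofPred]⟩,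
      ⟨⟨k + 1, hk⟩, by simp [ofPred]⟩, Finset.disjoint_left.2 fun m hm hm' => ?_⟩).trans
      (Finset.ext fun m => ?_))
    · simp only [ofPred, Finset.mem_union, Finset.mem_filter, Finset.mem_univ, true_and]
      omega
    · simp only [ofPred, Finset.mem_filter, Finset.mem_univ, true_and] at hm hm'
      omega

theorem not_isNilpotentOfDegree {d : ℕ} (hd : d ≤ n) :
    ¬ IsNilpotentOfDegree (DisjointUnions.{u} n) d := by
  rintro ⟨⟨k, rfl, z, hz, h⟩, -⟩
  -- The product of the singletons {0}, …, {k} is nonempty because k < n.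
  have h1 := h fun i => ofPred n (· = i)
  rw [seqProd_ofPred_eq (by omega), hz.eq isZeroElement_zero] at h1
  have h2 : (Finset.univ.filter fun m : Fin n => (m : ℕ) ≤ k) = ∅ := congrArg ULift.down h1
  have h3 : (⟨0, by omega⟩ : Fin n) ∈ Finset.univ.filter fun m : Fin n => (m : ℕ) ≤ k := by simp
  rw [h2] at h3
  simp at h3

end DisjointUnions

theorem not_nilVarietyF_subset {n : ℕ} {V : Set UnarySemigrp.{u}} (h : HasDegreeAtMost V n) :
    ¬ nilVarietyF (n + 1) ⊆ V := by
  intro hsub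
  obtain ⟨d, hd, hnil⟩ := h _ (hsub DisjointUnions.mem_nilVarietyF) DisjointUnions.isNilsemigroup
  exact DisjointUnions.not_isNilpotentOfDegree hd hnil

end NilpotentModel

end EpigroupVarieties

theorem corollary1p3 (n : ℕ) (hn : 1 ≤ n)
    (V : Set EpigroupVarieties.UnarySemigrp.{u})
    (hV : EpigroupVarieties.IsEpigroupVariety V) :
    List.TFAE
      [EpigroupVarieties.HasDegreeAtMost V n,
       ¬ (EpigroupVarieties.nilVarietyF (n + 1) ⊆ V),
       ∃ w : EpigroupVarieties.Word, (n : ℕ∞) < w.length ∧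
         EpigroupVarieties.ClassSatisfies V (EpigroupVarieties.Word.block 1 n) w,
       ∃ i j : ℕ, 1 ≤ i ∧ i ≤ j ∧ j ≤ n ∧
         EpigroupVarieties.ClassSatisfies V (EpigroupVarieties.Word.block 1 n)
           (EpigroupVarieties.Word.doubleBarWord n i j)] := by
  tfae_have 1 → 2 := EpigroupVarieties.not_nilVarietyF_subset
  tfae_have 2 → 3 := EpigroupVarieties.exists_long_identity_of_not_subset hn hV.1
  tfae_have 3 → 4 := fun ⟨_, hw, hVw⟩ =>
    EpigroupVarieties.exists_doubleBar_of_long_identity hn hV hw hVw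
  tfae_have 4 → 1 := fun ⟨_, _, _, _, _, hVw⟩ =>
    EpigroupVarieties.hasDegreeAtMost_of_doubleBar hn hV hVw
  tfae_finish
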